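/- Let $n\ge 1$ and, for real $p>0$, let $g_p(x)=\dfrac{\Gamma((p+n)/2)}{\pi^{n/2}\,\Gamma(p/2)}\,(1+|x|^2)^{-(p+n)/2}$, $x\in\mathbb R^n$, be the Student-$t$ density with $p$ degrees of freedom and identity scale. Let $X,Y$ be independent random vectors in $\mathbb R^n$ with densities $g_{p_x},g_{p_y}$, where $p_x,p_y$ are odd positive integers, and let $Z=(X+Y)/2$. Then $Z$ has a density $g_Z$, and there are $\alpha_k\ge 0$ with $\sum_k\alpha_k=1$ such that $$g_Z=\sum_{k=0}^{(p_x+p_y)/2-1}\alpha_k\,g_{2k+1}\quad\text{almost everywhere.}$$ For any such $\alpha_k$, let $W$ be a random variable with $P(W=2k+1)=\alpha_k$. Let $\varphi:\mathbb R^n\to[0,\infty)$ be a measurable weight function with $\int\varphi\, g_Z\,(1\vee|\log g_Z|)\,dx<\infty$ and $\mathbb E_{g_Z}[\varphi]\neq 0$, where $\mathbb E_f[h]=\int_{\mathbb R^n}h f\,dx$. Put $\psi(t)=\frac{d}{dt}\log\Gamma(t)$, $\Delta_n(p)=\psi\big(\frac{p+n}{2}\big)-\psi\big(\frac p2\big)$,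 and $$D_\varphi(f\|g)=\int_{\mathbb R^n}\varphi f\log\frac fg\,dx .$$ Then the integrals $D_\varphi(g_Z\|g_q)$ and $\mathbb E_{g_q}[\log(1+|X|^2)]$ ($q>0$), $\mathbb E_{g_Z}[\varphi]$, $\mathbb E_{g_Z}[\varphi\log(1+|X|^2)]$, and, for every $k$ with $\alpha_k\ne0$, $\mathbb E_{g_{2k+1}}[\varphi]$ and $\mathbb E_{g_{2k+1}}[\varphi\log(1+|X|^2)]$ converge absolutely. There is exactly one minimiser $p^*$ of $q\mapsto D_\varphi(g_Z\|g_q)$ on $(0,\infty)$. Moreover, for every $p^*>0$ the following are equivalent (terms with $\alpha_k=0$ are omitted in $\mathbb E_W$): 1. $D_\varphi(g_Z\|g_{p^*})\le D_\varphi(g_Z\|g_q)$ for all $q>0$; 2. $\displaystyle \Delta_n(p^*)=\frac{\mathbb E_W\big(\mathbb E_{g_W}[\varphi\log(1+|X|^2)]\big)}{\mathbb E_W\big(\mathbb E_{g_W}[\varphi]\big)}$; 3. $\displaystyle \mathbb E_{g_{p^*}}[\log(1+|X|^2)]\;\mathbb E_{g_Z}[\varphi]=\mathbb E_{g_Z}[\varphi\log(1+|X|^2)]$.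 -/

import Mathlib

open MeasureTheory ProbabilityTheory

noncomputable section

namespace StudentKL

/-- The `n`-dimensional Student-t density with `p > 0` degrees of freedom and identity scale matrix,
`g_p(x) = Γ((p+n)/2) / (π^{n/2} Γ(p/2)) * (1 + xᵀx)^{-(p+n)/2}`. -/
def density (n : ℕ) (p : ℝ) (x : EuclideanSpace ℝ (Fin n)) : ℝ :=
  Real.Gamma ((p + n) / 2) / (Real.pi ^ ((n : ℝ) / 2) * Real.Gamma (p / 2)) *
    (1 + ‖x‖ ^ 2) ^ (-((p + n) / 2))

/-- The law on `ℝⁿ` with Lebesgue density `g_p`. -/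
def law (n : ℕ) (p : ℝ) : Measure (EuclideanSpace ℝ (Fin n)) :=
  volume.withDensity fun x => ENNReal.ofReal (density n p x)

/-- `E_f[h] = ∫ h f dx`, the expectation of `h` under the probability density `f`. -/
def expect {n : ℕ} (f h : EuclideanSpace ℝ (Fin n) → ℝ) : ℝ := ∫ x, h x * f x

/-- The integral `E_f[h]` converges absolutely. -/
def FiniteExpect {n : ℕ} (f h : EuclideanSpace ℝ (Fin n) → ℝ) : Prop :=
  Integrable fun x => h x * f x

/-- The weighted Kullback-Leibler divergence `∫ φ f log (f / g) dx`
(`Real.log 0 = 0` gives the convention `0 log 0 = 0`). -/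
def weightedKL {n : ℕ} (φ f g : EuclideanSpace ℝ (Fin n) → ℝ) : ℝ :=
  ∫ x, φ x * f x * Real.log (f x / g x)

/-- The function `x ↦ log (1 + xᵀx)`. -/
def logMoment {n : ℕ} (x : EuclideanSpace ℝ (Fin n)) : ℝ := Real.log (1 + ‖x‖ ^ 2)

/-- The digamma function `ψ(t) = d/dt log Γ(t)` of a real variable. -/
def psi (t : ℝ) : ℝ := deriv (fun s => Real.log (Real.Gamma s)) t

/-- `Δ_n(p) = ψ((p+n)/2) - ψ(p/2)`. -/
def Delta (n : ℕ) (p : ℝ) : ℝ := psi ((p + n) / 2) - psi (p / 2)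

/-- `α_0, …, α_{K-1}` are the weights of a probability distribution, and the density `f` is
almost everywhere the corresponding mixture `∑_k α_k g_{2k+1}`. -/
structure IsMixture {n : ℕ} (K : ℕ) (α : ℕ → ℝ) (f : EuclideanSpace ℝ (Fin n) → ℝ) : Prop where
  nonneg : ∀ k ∈ Finset.range K, 0 ≤ α k
  sum_eq_one : ∑ k ∈ Finset.range K, α k = 1
  ae_eq : f =ᵐ[volume] fun x => ∑ k ∈ Finset.range K, α k * density n (2 * k + 1) x

/-- `E_W[h(W)]` for a random variable `W` with `P(W = 2k+1) = α_k`, `0 ≤ k < K`. -/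
def expectW (K : ℕ) (α : ℕ → ℝ) (h : ℝ → ℝ) : ℝ :=
  ∑ k ∈ Finset.range K, α k * h (2 * k + 1)

end StudentKL

end

/-! Mixture. As `g_p` is a Gamma mixture of Gaussians, its characteristic function is a normalised
Bessel integral in `u = |t|`. For `p = 2k + 1` this equals `θ_k(u) e^{-u} / (1·3⋯(2k-1))`, where
`θ_k` is the Bessel polynomial `besselPoly k` (`charFun_law_odd`). The transform of the half-sum is
thus a constant times `θ_k(u/2) θ_l(u/2) e^{-u}`. By uniqueness of characteristic functions,
`exists_mixture` reduces to `θ_k(u/2) θ_l(u/2)` being a nonnegative combination of `θ_0(u), …,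
θ_{k+l}(u)` (`besselPoly_comp_mul_comp_mem_besselCone`).

Positivity. Since `θ_{k+1} - θ_{k+1}' = u θ_k`, applying `1 - d/du` to `θ_{k+1}(au) θ_{l+1}(bu)`
with `a + b = 1` gives `u` times a nonnegative combination of products of smaller total index. The
inverse operator sends `u θ_i` to `θ_{i+1}`, so induction on `k + l` applies. If one index is zero,
a single `θ_k(au)` remains, and `1 - d/du` is replaced by `a - d/du`. Its inverse preserves
positivity because `θ_m` has nonnegative coefficients in the basis `1, uθ_0, uθ_1, …`
(`besselPoly_eq_sum`), a generating function identity.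

Minimiser. `log g_q` is affine in `log(1+|x|²)`, so up to a constant the divergence is `qB/2 - A
(log Γ((q+n)/2) - log Γ(q/2))`, where `A` and `B` are the `g_Z`-expectations of `φ` and `φ
log(1+|x|²)`. Its derivative is `(B - A Δ_n(q))/2`. Now `Δ_n(q)` is the logarithmic moment of `g_q`
(`expect_density_logMoment`), is strictly decreasing by a likelihood ratio argument
(`strictAntiOn_Delta`), and takes every positive value (`exists_Delta_eq`). So `Δ_n(p) = B/A` has
exactly one root, which is the minimiser. -/

noncomputable section

/-! ### Bessel polynomials: recurrences -/

namespace StudentKL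

open Polynomial NNReal

/-- The (reverse) Bessel polynomials. -/
def besselPoly : ℕ → ℝ[X]
  | 0 => 1
  | 1 => X + 1
  | k + 2 => C (2 * k + 3 : ℝ) * besselPoly (k + 1) + X ^ 2 * besselPoly k

/-- The sequence `1, X θ₀, X θ₁, …` of binomial type attached to the Bessel polynomials. -/
def carlitzPoly : ℕ → ℝ[X]
  | 0 => 1
  | k + 1 => X * besselPoly k

/-- `1 · 3 ⋯ (2k - 1)`. -/
def oddFactorial : ℕ → ℝ
  | 0 => 1
  | k + 1 => (2 * k + 1) * oddFactorial k

lemma oddFactorial_pos (k : ℕ) : 0 < oddFactorial k := by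
  induction k with
  | zero => simp [oddFactorial]
  | succ k ih => rw [oddFactorial]; positivity

lemma besselPoly_succ_eq (k : ℕ) :
    besselPoly (k + 1) = C (2 * k + 1 : ℝ) * besselPoly k + X * carlitzPoly k := by
  cases k with
  | zero => simp [besselPoly, carlitzPoly]; ring
  | succ k =>
    rw [besselPoly, carlitzPoly]
    have : (2 * (k : ℝ) + 3) = 2 * ((k + 1 : ℕ) : ℝ) + 1 := by push_cast; ring
    rw [this]; ring

lemma besselPoly_eval_zero (k : ℕ) : (besselPoly k).eval 0 = oddFactorial k := by
  induction k with
  | zero => simp [besselPoly, oddFactorial]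
  | succ k ih => rw [besselPoly_succ_eq, oddFactorial]; simp [ih]

/-- Equivalently `(θ_k e^{-u})' = -u θ_{k-1} e^{-u}` for `k ≥ 1`: the operator `1 - d/du` lowers the
index. The positivity inductions rest on this. -/
lemma derivative_besselPoly (k : ℕ) :
    derivative (besselPoly k) = besselPoly k - carlitzPoly k := by
  induction k using Nat.strong_induction_on with
  | _ k ih =>
  match k with
  | 0 => simp [besselPoly, carlitzPoly]
  | 1 => simp [besselPoly, carlitzPoly]
  | k + 2 =>
    have h1 := ih (k + 1) (by omega)
    have h0 := ih k (by omega)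
    have h2 := besselPoly_succ_eq k
    rw [besselPoly, derivative_add, derivative_mul, derivative_mul, h1, h0]
    simp only [carlitzPoly, derivative_C, derivative_X_pow]
    simp only [map_add, map_mul] at h2 ⊢
    have e3 : (C (3 : ℝ) : ℝ[X]) = 3 := rfl
    have e2 : (C (2 : ℝ) : ℝ[X]) = 2 := rfl
    have e1 : (C (1 : ℝ) : ℝ[X]) = 1 := rfl
    simp only [e3, e2, e1] at h2 ⊢
    have e2' : (C ((2 : ℕ) : ℝ) : ℝ[X]) = 2 := rfl
    simp only [e2']
    cases k <;> simp only [carlitzPoly] at h2 ⊢ <;> linear_combination X * h2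

/-! ### Exponential generating functions -/

section PowerSeriesIdentity

/-- Uniqueness for a formal linear ODE: the equation determines the coefficient of index `n + 1`
from those of index at most `n`. -/
lemma powerSeries_eq_zero_of_derivative_eq_mul
    (w r : PowerSeries ℝ) (h0 : PowerSeries.constantCoeff w = 0)
    (h : PowerSeries.derivative ℝ w = r * w) : w = 0 := by
  have key : ∀ n, PowerSeries.coeff n w = 0 := by
    intro n
    induction n using Nat.strong_induction_on with
    | _ n ih =>
    cases n with
    | zero => simpa using h0
    | succ n =>
      have h1 := congrArg (PowerSeries.coeff n) h
      rw [PowerSeries.coeff_derivative, PowerSeries.coeff_mul, Finset.sum_eq_zero] at h1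
      · exact (mul_eq_zero.mp h1).resolve_right (by positivity)
      · intro x hx
        rw [ih x.2 (by have := Finset.HasAntidiagonal.mem_antidiagonal.mp hx; omega), mul_zero]
  ext n; simpa using key n

/-- The exponential generating function of a sequence. -/
def egf (f : ℕ → ℝ) : PowerSeries ℝ := PowerSeries.mk fun k => (k.factorial : ℝ)⁻¹ * f k

lemma constantCoeff_egf (f : ℕ → ℝ) : PowerSeries.constantCoeff (egf f) = f 0 := by
  rw [← PowerSeries.coeff_zero_eq_constantCoeff_apply, egf, PowerSeries.coeff_mk]
  simp

lemma derivative_egf (f : ℕ → ℝ) :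
    PowerSeries.derivative ℝ (egf f) = egf fun k => f (k + 1) := by
  ext1 k
  rw [PowerSeries.coeff_derivative, egf, egf, PowerSeries.coeff_mk, PowerSeries.coeff_mk,
    Nat.factorial_succ]
  push_cast
  field_simp

lemma X_mul_derivative_egf (f : ℕ → ℝ) :
    PowerSeries.X * PowerSeries.derivative ℝ (egf f) = egf fun k => k * f k := by
  ext1 k
  cases k with
  | zero => simp [egf]
  | succ k =>
    rw [mul_comm, PowerSeries.coeff_succ_mul_X, derivative_egf, egf, egf, PowerSeries.coeff_mk,
      PowerSeries.coeff_mk, Nat.factorial_succ]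
    push_cast
    field_simp

lemma egf_add (f g : ℕ → ℝ) : egf f + egf g = egf (f + g) := by
  ext1 k; simp [egf, mul_add]

lemma C_mul_egf (c : ℝ) (f : ℕ → ℝ) : PowerSeries.C c * egf f = egf fun k => c * f k := by
  ext1 k; rw [PowerSeries.coeff_C_mul]; simp [egf]; ring

lemma coeff_egf_mul_egf (f g : ℕ → ℝ) (k : ℕ) :
    (k.factorial : ℝ) * PowerSeries.coeff k (egf f * egf g) =
      ∑ ij ∈ Finset.HasAntidiagonal.antidiagonal k, (k.choose ij.1 : ℝ) * (f ij.1 * g ij.2) := by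
  rw [PowerSeries.coeff_mul, Finset.mul_sum]
  refine Finset.sum_congr rfl fun ij hij => ?_
  rw [egf, egf, PowerSeries.coeff_mk, PowerSeries.coeff_mk]
  have hk := Finset.HasAntidiagonal.mem_antidiagonal.mp hij
  have : (k.choose ij.1 : ℝ) = k.factorial * ((ij.1.factorial : ℝ)⁻¹ * (ij.2.factorial : ℝ)⁻¹) := by
    rw [← hk, Nat.choose_symm_add, Nat.add_choose,
      Nat.cast_div (Nat.factorial_mul_factorial_dvd_factorial_add _ _)
      (by positivity)]
    push_cast; field_simp
  rw [this]; ring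

/-- In closed form `egf oddFactorial` is `(1-2z)^{-1/2}` and the series of `carlitzPoly` is `F =
exp(x(1 - √(1-2z)))`. As `F' = xG` with `G` the series of `besselPoly`, this gives `G =
(1-2z)^{-1/2} F`. The recurrences become differential equations, so no closed form is needed. -/
lemma egf_besselPoly (x : ℝ) :
    egf (fun k => (besselPoly k).eval x) =
      egf oddFactorial * egf (fun k => (carlitzPoly k).eval x) := by
  set r := egf oddFactorial with hr
  set F := egf (fun k => (carlitzPoly k).eval x) with hF
  set G := egf (fun k => (besselPoly k).eval x) with hG
  set D := PowerSeries.derivative ℝ with hD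
  set u : PowerSeries ℝ := PowerSeries.C x with hu
  have two : (2 : PowerSeries ℝ) = PowerSeries.C (2 : ℝ) := rfl
  have hr' : (1 - 2 * PowerSeries.X) * D r = r := by
    have h1 : D r = r + 2 * (PowerSeries.X * D r) := by
      rw [hr, X_mul_derivative_egf, derivative_egf, two, C_mul_egf, egf_add]
      congr 1
      ext k
      simp only [oddFactorial, Pi.add_apply]; ring
    linear_combination h1
  have hF' : D F = u * G := by
    rw [hF, derivative_egf, hu, hG, C_mul_egf]
    congr 1
    ext k
    simp [carlitzPoly]
  have hG' : (1 - 2 * PowerSeries.X) * D G = G + u * F := by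
    have h1 : D G = G + u * F + 2 * (PowerSeries.X * D G) := by
      rw [hG, X_mul_derivative_egf, derivative_egf, two, hu, hF, C_mul_egf x, C_mul_egf 2, egf_add,
        egf_add]
      congr 1
      ext k
      simp [besselPoly_succ_eq]; ring
    linear_combination h1
  -- `r` plays the role of `(1-2X)^{-1/2}` and `v` that of `(1-2X)^{1/2}`; `hvr` and `hv2` confirm
  -- this from the differential equation of `r`.
  set v := (1 - 2 * PowerSeries.X) * r with hv
  have hDX : D (1 - 2 * PowerSeries.X) = -2 := by
    rw [two, map_sub, Derivation.leibniz, PowerSeries.derivative_C]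
    simp [hD]
  have hv' : D v = -r := by
    rw [hv, Derivation.leibniz, hDX]
    simp only [smul_eq_mul]
    linear_combination hr'
  have hr0 : PowerSeries.constantCoeff r = 1 := by
    rw [hr, constantCoeff_egf, oddFactorial]
  have hF0 : PowerSeries.constantCoeff F = 1 := by
    rw [hF, constantCoeff_egf]; simp [carlitzPoly]
  have hG0 : PowerSeries.constantCoeff G = 1 := by
    rw [hG, constantCoeff_egf]; simp [besselPoly]
  have hvr : v * r = 1 := by
    have : v * r - 1 = 0 := by
      apply powerSeries_eq_zero_of_derivative_eq_mul _ 0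
      · simp [hv, hr0]
      · change D _ = _
        rw [map_sub, Derivation.leibniz, hv', hD, Derivation.map_one_eq_zero]
        simp only [smul_eq_mul]
        rw [hv]; linear_combination r * hr'
    linear_combination this
  have hv2 : v * v = 1 - 2 * PowerSeries.X := by
    linear_combination (1 - 2 * PowerSeries.X) * hvr + v * hv
  have hW : v * G - F = 0 := by
    apply powerSeries_eq_zero_of_derivative_eq_mul _ (-(r * u))
    · simp [hv, hr0, hF0, hG0]
    · change D _ = _
      rw [map_sub, Derivation.leibniz, hv', hF']
      simp only [smul_eq_mul]
      have : v * (v * D G) = G + u * F := by rw [← hG', ← hv2]; ring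
      linear_combination r * this + (-(v * D G) + u * G) * hvr
  linear_combination r * hW - G * hvr

end PowerSeriesIdentity

lemma besselPoly_eq_sum (k : ℕ) : besselPoly k =
    ∑ ij ∈ Finset.HasAntidiagonal.antidiagonal k,
      C ((k.choose ij.1 : ℝ) * oddFactorial ij.1) * carlitzPoly ij.2 := by
  refine Polynomial.funext fun x => ?_
  have h := congrArg (fun s => (k.factorial : ℝ) * PowerSeries.coeff k s) (egf_besselPoly x)
  simp only [coeff_egf_mul_egf] at h
  rw [egf, PowerSeries.coeff_mk, ← mul_assoc, mul_inv_cancel₀ (by positivity), one_mul] at h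
  rw [h, eval_finsetSum]
  refine Finset.sum_congr rfl fun ij _ => ?_
  rw [eval_mul, eval_C, mul_assoc]

/-! ### Positivity of the linearization coefficients -/

/-- The convex cone spanned by the first `N` Bessel polynomials. -/
def besselCone (N : ℕ) : Submodule ℝ≥0 ℝ[X] := Submodule.span ℝ≥0 (besselPoly '' Set.Iio N)

lemma besselPoly_mem_besselCone {k N : ℕ} (h : k < N) : besselPoly k ∈ besselCone N :=
  Submodule.subset_span ⟨k, h, rfl⟩

lemma besselCone_mono {M N : ℕ} (h : M ≤ N) : besselCone M ≤ besselCone N :=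
  Submodule.span_mono (Set.image_mono (Set.Iio_subset_Iio h))

lemma C_mul_mem_besselCone {N : ℕ} {c : ℝ} (hc : 0 ≤ c) {f : ℝ[X]} (hf : f ∈ besselCone N) :
    C c * f ∈ besselCone N := by
  have := (besselCone N).smul_mem (⟨c, hc⟩ : ℝ≥0) hf
  rwa [NNReal.smul_def (⟨c, hc⟩ : ℝ≥0) f, Polynomial.smul_eq_C_mul] at this

lemma exists_coeff_of_mem_besselCone {N : ℕ} {f : ℝ[X]} (hf : f ∈ besselCone N) :
    ∃ c : ℕ → ℝ, (∀ k, 0 ≤ c k) ∧ f = ∑ k ∈ Finset.range N, C (c k) * besselPoly k := by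
  induction hf using Submodule.span_induction with
  | mem x h =>
    obtain ⟨k, hk, rfl⟩ := h
    refine ⟨Pi.single k 1, fun j => ?_, ?_⟩
    · by_cases h : j = k
      · subst h; simp
      · simp [h]
    · rw [Finset.sum_eq_single_of_mem k (Finset.mem_range.mpr hk)]
      · simp
      · intro b _ hb; simp [hb]
  | zero => exact ⟨0, fun _ => le_rfl, by simp⟩
  | add x y _ _ hx hy =>
    obtain ⟨c, hc, rfl⟩ := hx
    obtain ⟨d, hd, rfl⟩ := hy
    refine ⟨c + d, fun k => add_nonneg (hc k) (hd k), ?_⟩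
    rw [← Finset.sum_add_distrib]
    refine Finset.sum_congr rfl fun k _ => ?_
    simp [add_mul]
  | smul a x _ hx =>
    obtain ⟨c, hc, rfl⟩ := hx
    refine ⟨fun k => a * c k, fun k => mul_nonneg a.2 (hc k), ?_⟩
    rw [NNReal.smul_def, Polynomial.smul_eq_C_mul, Finset.mul_sum]
    refine Finset.sum_congr rfl fun k _ => ?_
    rw [C_mul, mul_assoc]

/-- Differentiation lowers the degree, so `a - d/du` has trivial kernel on polynomials. -/
lemma eq_of_C_mul_sub_derivative_eq {a : ℝ} (ha : a ≠ 0) {f g : ℝ[X]}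
    (h : C a * f - derivative f = C a * g - derivative g) : f = g := by
  have h1 : C a * (f - g) = derivative (f - g) := by
    rw [derivative_sub]; linear_combination h
  by_contra hne
  have hne' : f - g ≠ 0 := sub_ne_zero.mpr hne
  have hlt := degree_derivative_lt hne'
  rw [← h1, degree_C_mul ha] at hlt
  exact lt_irrefl _ hlt

/-- Write `p_m` for `carlitzPoly m`. Then `(a - d/du) θ_m = p_m - (1-a) θ_m`, and by induction some
`g` in the cone has image `θ_m - p_m`, a nonnegative combination of the earlier `p_j`. So `θ_m +
(1-a) g` has image `a p_m`; `a ≤ 1` keeps it in the cone. -/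
lemma exists_mem_besselCone_of_carlitzPoly {a : ℝ} (ha : 0 < a) (ha1 : a ≤ 1) (m : ℕ) :
    ∃ f ∈ besselCone (m + 1), C a * f - derivative f = carlitzPoly m := by
  induction m using Nat.strong_induction_on with
  | _ m ih =>
  choose! f hf hf' using ih
  have hsum := besselPoly_eq_sum m
  rw [Finset.Nat.sum_antidiagonal_eq_sum_range_succ
    (f := fun i j => C ((m.choose i : ℝ) * oddFactorial i) * carlitzPoly j),
    Finset.sum_range_succ'] at hsum
  simp only [Nat.choose_zero_right, oddFactorial, Nat.cast_one, mul_one, C_1, one_mul,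
    Nat.sub_zero] at hsum
  -- The connection coefficient of index `i + 1`; the split-off term of index 0 is `carlitzPoly m`
  -- itself.
  set d : ℕ → ℝ := fun i => (m.choose (i + 1) : ℝ) * ((2 * i + 1) * oddFactorial i) with hd
  have hd0 : ∀ i, 0 ≤ d i := fun i => by have := oddFactorial_pos i; positivity
  set g : ℝ[X] := ∑ i ∈ Finset.range m, C (d i) * f (m - (i + 1)) with hg
  have hgmem : g ∈ besselCone (m + 1) := by
    refine Submodule.sum_mem _ fun i hi => ?_
    have hi := Finset.mem_range.mp hi
    exact C_mul_mem_besselCone (hd0 i) (besselCone_mono (by omega) (hf _ (by omega)))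
  have hg' : C a * g - derivative g = besselPoly m - carlitzPoly m := by
    rw [hg, Finset.mul_sum, derivative_sum, ← Finset.sum_sub_distrib, hsum, add_sub_cancel_right]
    refine Finset.sum_congr rfl fun i hi => ?_
    have hi := Finset.mem_range.mp hi
    rw [derivative_C_mul, ← hf' _ (by omega : m - (i + 1) < m)]
    ring
  refine ⟨C a⁻¹ * (besselPoly m + C (1 - a) * g), C_mul_mem_besselCone (by positivity)
    (add_mem (besselPoly_mem_besselCone (by omega))
      (C_mul_mem_besselCone (by linarith) hgmem)), ?_⟩
  have hinv : C a⁻¹ * C a = (1 : ℝ[X]) := by rw [← C_mul, inv_mul_cancel₀ ha.ne', C_1]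
  rw [derivative_C_mul, derivative_add, derivative_C_mul, derivative_besselPoly, C_sub, C_1]
  linear_combination C a⁻¹ * (1 - C a) * hg' + carlitzPoly m * hinv

lemma exists_mem_besselCone_of_X_mul {a : ℝ} (ha : 0 < a) (ha1 : a ≤ 1) {N : ℕ} {f : ℝ[X]}
    (hf : f ∈ besselCone N) : ∃ g ∈ besselCone (N + 1), C a * g - derivative g = X * f := by
  obtain ⟨c, hc, rfl⟩ := exists_coeff_of_mem_besselCone hf
  choose g hg hg' using exists_mem_besselCone_of_carlitzPoly ha ha1
  refine ⟨∑ k ∈ Finset.range N, C (c k) * g (k + 1), Submodule.sum_mem _ fun k hk => ?_, ?_⟩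
  · have := Finset.mem_range.mp hk
    exact C_mul_mem_besselCone (hc k) (besselCone_mono (by omega) (hg _))
  · rw [Finset.mul_sum, derivative_sum, ← Finset.sum_sub_distrib, Finset.mul_sum]
    refine Finset.sum_congr rfl fun k _ => ?_
    have := hg' (k + 1)
    rw [carlitzPoly] at this
    rw [derivative_C_mul]
    linear_combination C (c k) * this

lemma derivative_besselPoly_comp (a : ℝ) (k : ℕ) :
    derivative ((besselPoly k).comp (C a * X)) =
      C a * (besselPoly k).comp (C a * X) - C a * (carlitzPoly k).comp (C a * X) := by
  rw [derivative_comp, derivative_besselPoly]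
  simp; ring

lemma carlitzPoly_succ_comp (a : ℝ) (k : ℕ) :
    (carlitzPoly (k + 1)).comp (C a * X) = C a * X * (besselPoly k).comp (C a * X) := by
  simp [carlitzPoly]

/-- Induction through `(a - d/du) θ_{k+1}(au) = a² u θ_k(au)`, inverting `a - d/du` inside the cone.
-/
lemma besselPoly_comp_mem_besselCone {a : ℝ} (ha : 0 < a) (ha1 : a ≤ 1) (k : ℕ) :
    (besselPoly k).comp (C a * X) ∈ besselCone (k + 1) := by
  induction k with
  | zero =>
    have := besselPoly_mem_besselCone (show 0 < 0 + 1 by omega)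
    simpa [besselPoly] using this
  | succ k ih =>
    obtain ⟨g, hg, hg'⟩ := exists_mem_besselCone_of_X_mul ha ha1 ih
    have : (besselPoly (k + 1)).comp (C a * X) = C (a ^ 2) * g := by
      apply eq_of_C_mul_sub_derivative_eq ha.ne'
      rw [derivative_besselPoly_comp, carlitzPoly_succ_comp, derivative_C_mul, C_pow]
      linear_combination -C a ^ 2 * hg'
    rw [this]
    exact C_mul_mem_besselCone (by positivity) hg

/-- Products of rescaled Bessel polynomials, with scales adding up to one, have nonnegative
linearization coefficients. -/
theorem besselPoly_comp_mul_comp_mem_besselCone {a b : ℝ} (ha : 0 < a) (hb : 0 < b)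
    (hab : a + b = 1) (k l : ℕ) :
    (besselPoly k).comp (C a * X) * (besselPoly l).comp (C b * X) ∈ besselCone (k + l + 1) := by
  induction hN : k + l generalizing k l with
  | zero =>
    obtain ⟨rfl, rfl⟩ : k = 0 ∧ l = 0 := by omega
    have := besselPoly_mem_besselCone (show 0 < 0 + 1 by omega)
    simpa [besselPoly] using this
  | succ N ih =>
    match k, l with
    -- A zero index is treated apart: `carlitzPoly 0 = 1` carries no factor `X`, so the product rule
    -- below would not yield `X` times a cone element.
    | 0, l =>
      have := besselPoly_comp_mem_besselCone hb (by linarith) l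
      rw [show l = N + 1 by omega] at this ⊢
      simpa [besselPoly] using this
    | k, 0 =>
      have := besselPoly_comp_mem_besselCone ha (by linarith) k
      rw [show k = N + 1 by omega] at this ⊢
      simpa [besselPoly] using this
    | k + 1, l + 1 =>
      have h1 := ih k (l + 1) (by omega)
      have h2 := ih (k + 1) l (by omega)
      obtain ⟨g, hg, hg'⟩ := exists_mem_besselCone_of_X_mul one_pos le_rfl
        (add_mem (C_mul_mem_besselCone (sq_nonneg a) h1) (C_mul_mem_besselCone (sq_nonneg b) h2))
      convert hg using 1
      apply eq_of_C_mul_sub_derivative_eq one_ne_zero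
      have hab' : (C a : ℝ[X]) + C b = 1 := by rw [← C_add, hab, C_1]
      rw [hg', derivative_mul, derivative_besselPoly_comp, derivative_besselPoly_comp,
        carlitzPoly_succ_comp, carlitzPoly_succ_comp, C_1, C_pow, C_pow]
      linear_combination -((besselPoly (k + 1)).comp (C a * X) *
        (besselPoly (l + 1)).comp (C b * X)) * hab'

end StudentKL

/-! ### Bessel integrals of half-integer order -/

namespace StudentKL

open Set Filter Topology Real

/-- Only a one-sided limit at `a` is required, since primitives containing `s⁻¹` take an irrelevant
default value at `s = 0`; `Function.update` replaces that value by the limit. -/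
lemma integral_Ioi_of_hasDerivAt_of_tendsto_nhdsGT {f f' : ℝ → ℝ} {a l m : ℝ}
    (hl : Tendsto f (𝓝[>] a) (𝓝 l)) (hderiv : ∀ x ∈ Ioi a, HasDerivAt f (f' x) x)
    (f'int : IntegrableOn f' (Ioi a)) (hm : Tendsto f atTop (𝓝 m)) :
    ∫ x in Ioi a, f' x = m - l := by
  have h := integral_Ioi_of_hasDerivAt_of_tendsto (f := Function.update f a l) (f' := f')
    (a := a) (m := m) ?_ ?_ f'int ?_
  · simpa using h
  · rw [continuousWithinAt_update_same, Ici_sdiff_left]; exact hl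
  · intro x hx
    refine (hderiv x hx).congr_of_eventuallyEq ?_
    filter_upwards [Ioi_mem_nhds hx] with y hy
    rw [Function.update_of_ne (ne_of_gt hy)]
  · refine hm.congr' ?_
    filter_upwards [Ioi_mem_atTop a] with y hy
    rw [Function.update_of_ne (ne_of_gt hy)]

/-- The integrand of `besselInt`. -/
def besselKernel (ν u s : ℝ) : ℝ := s ^ (ν - 1) * exp (-(s + u ^ 2 / (4 * s)))

/-- `∫₀^∞ s^(ν-1) exp (-s - u²/(4s)) ds`, which is `2 (u/2)^ν K_ν(u)`. -/
def besselInt (ν u : ℝ) : ℝ := ∫ s in Ioi 0, besselKernel ν u s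

lemma measurable_besselKernel (ν u : ℝ) : Measurable (besselKernel ν u) := by
  unfold besselKernel; fun_prop

/-- From `e^{-y} ≤ 1/y` with `y = u²/(4s)`. The factor `s` gained makes the kernel integrable for `ν
> -1`, which covers the order `-1/2`. -/
lemma besselKernel_le {ν u s : ℝ} (hu : 0 < u) (hs : 0 < s) :
    besselKernel ν u s ≤ (4 / u ^ 2) * (exp (-s) * s ^ (ν + 1 - 1)) := by
  have h1 : exp (-(u ^ 2 / (4 * s))) ≤ 4 * s / u ^ 2 := by
    rw [exp_neg, show 4 * s / u ^ 2 = (u ^ 2 / (4 * s))⁻¹ by rw [inv_div]]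
    gcongr
    exact (by linarith [add_one_le_exp (u ^ 2 / (4 * s))])
  rw [besselKernel, neg_add, exp_add]
  calc s ^ (ν - 1) * (exp (-s) * exp (-(u ^ 2 / (4 * s))))
      ≤ s ^ (ν - 1) * (exp (-s) * (4 * s / u ^ 2)) := by gcongr
    _ = _ := by
      rw [show ν + 1 - 1 = (ν - 1) + 1 by ring, rpow_add_one hs.ne']; ring

lemma integrableOn_besselKernel {ν u : ℝ} (hν : -1 < ν) (hu : 0 < u) :
    IntegrableOn (besselKernel ν u) (Ioi 0) := by
  refine ((GammaIntegral_convergent (by linarith : 0 < ν + 1)).const_mul (4 / u ^ 2)).mono'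
    (measurable_besselKernel ν u).aestronglyMeasurable ?_
  filter_upwards [ae_restrict_mem measurableSet_Ioi] with s hs
  have hs : 0 < s := hs
  rw [norm_of_nonneg (by unfold besselKernel; positivity)]
  exact besselKernel_le hu hs

lemma besselInt_zero_right {ν : ℝ} (hν : 0 < ν) : besselInt ν 0 = Gamma ν := by
  rw [besselInt, Gamma_eq_integral hν]
  refine setIntegral_congr_fun measurableSet_Ioi fun s _ => ?_
  simp only [besselKernel]; rw [mul_comm]; simp

/-- Integration by parts: `s^ν exp(-(s + u²/(4s)))` vanishes at both ends, so its derivative has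
integral zero. -/
lemma besselInt_add_one {ν u : ℝ} (hν : 0 < ν) (hu : 0 < u) :
    besselInt (ν + 1) u = ν * besselInt ν u + u ^ 2 / 4 * besselInt (ν - 1) u := by
  have i1 := (integrableOn_besselKernel (by linarith : -1 < ν + 1) hu)
  have i2 := (integrableOn_besselKernel (by linarith : -1 < ν) hu).const_mul ν
  have i3 := (integrableOn_besselKernel (by linarith : -1 < ν - 1) hu).const_mul (u ^ 2 / 4)
  have i23 : IntegrableOn (fun s => ν * besselKernel ν u s + u ^ 2 / 4 * besselKernel (ν - 1) u s)
    (Ioi 0) := i2.add i3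
  have key : ∫ s in Ioi 0, (ν * besselKernel ν u s + u ^ 2 / 4 * besselKernel (ν - 1) u s
      - besselKernel (ν + 1) u s) = 0 - 0 := by
    apply integral_Ioi_of_hasDerivAt_of_tendsto_nhdsGT
      (f := fun s => s ^ ν * exp (-(s + u ^ 2 / (4 * s))))
      (f' := fun s => ν * besselKernel ν u s + u ^ 2 / 4 * besselKernel (ν - 1) u s
        - besselKernel (ν + 1) u s) _ _ (i23.sub i1)
    · have h := tendsto_rpow_mul_exp_neg_mul_atTop_nhds_zero ν 1 one_pos
      refine squeeze_zero' ?_ ?_ h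
      · filter_upwards [eventually_gt_atTop 0] with s hs; positivity
      · filter_upwards [eventually_gt_atTop 0] with s hs
        gcongr
        have : 0 ≤ u ^ 2 / (4 * s) := by positivity
        linarith
    · have h : Tendsto (fun s : ℝ => s ^ ν) (𝓝[>] 0) (𝓝 0) := by
        have := (continuousAt_rpow_const 0 ν (Or.inr hν.le)).tendsto
        rw [zero_rpow hν.ne'] at this
        exact this.mono_left nhdsWithin_le_nhds
      refine squeeze_zero' ?_ ?_ h
      · filter_upwards [self_mem_nhdsWithin] with s hs
        have hs : 0 < s := hs
        positivity
      · filter_upwards [self_mem_nhdsWithin] with s hs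
        have hs : 0 < s := hs
        refine mul_le_of_le_one_right (by positivity) (exp_le_one_iff.mpr ?_)
        have : 0 ≤ u ^ 2 / (4 * s) := by positivity
        linarith
    · intro s hs
      have hs : 0 < s := hs
      have d1 := hasDerivAt_rpow_const (x := s) (p := ν) (Or.inl hs.ne')
      have d2 : HasDerivAt (fun s : ℝ => -(s + u ^ 2 / 4 * s⁻¹)) (-(1 + u ^ 2 / 4 * -(s ^ 2)⁻¹)) s :=
        ((hasDerivAt_id s).add ((hasDerivAt_inv hs.ne').const_mul _)).neg
      have d3 := d1.mul d2.exp
      have e : ∀ t : ℝ, u ^ 2 / 4 * t⁻¹ = u ^ 2 / (4 * t) := fun t => by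
        rw [div_mul_eq_div_div, div_eq_mul_inv _ t]
      simp only [e] at d3
      refine d3.congr_deriv ?_
      have r1 : s ^ ν = s ^ (ν - 1) * s := by rw [rpow_sub_one hs.ne']; field_simp
      have r2 : s ^ (ν - 1 - 1) = s ^ (ν - 1) * s⁻¹ := by
        rw [rpow_sub_one hs.ne' (ν - 1)]; rfl
      have r3 : s ^ (ν + 1 - 1) = s ^ (ν - 1) * s := by rw [← r1]; ring_nf
      simp only [besselKernel, r2, r3, r1]
      field_simp; ring
  rw [integral_sub i23 i1, integral_add i2 i3, integral_const_mul, integral_const_mul] at key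
  simp only [besselInt]; linarith

/-- A primitive of the Gaussian `exp (-x²)`. -/
def gaussPrimitive (y : ℝ) : ℝ := ∫ x in (0 : ℝ)..y, exp (-1 * x ^ 2)

lemma hasDerivAt_gaussPrimitive (y : ℝ) : HasDerivAt gaussPrimitive (exp (-1 * y ^ 2)) y := by
  have hc : Continuous fun x : ℝ => exp (-1 * x ^ 2) := by fun_prop
  exact intervalIntegral.integral_hasDerivAt_right (hc.intervalIntegrable _ _)
    (hc.stronglyMeasurableAtFilter _ _) hc.continuousAt

lemma tendsto_gaussPrimitive_atTop : Tendsto gaussPrimitive atTop (𝓝 (√π / 2)) := by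
  have h := intervalIntegral_tendsto_integral_Ioi 0
    (integrable_exp_neg_mul_sq one_pos).integrableOn tendsto_id
  rw [integral_gaussian_Ioi, div_one] at h
  exact h

lemma tendsto_gaussPrimitive_atBot : Tendsto gaussPrimitive atBot (𝓝 (-(√π / 2))) := by
  have h := (tendsto_gaussPrimitive_atTop.comp tendsto_neg_atBot_atTop).neg
  refine h.congr fun y => ?_
  have := intervalIntegral.integral_comp_neg (a := 0) (b := -y) fun x : ℝ => exp (-1 * x ^ 2)
  simp only [Function.comp, gaussPrimitive]
  rw [intervalIntegral.integral_symm y 0]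
  simp at this ⊢
  linarith

/-- Substitute `y = √s - c/√s`. As `c² = u²/4`, `y² = s - 2c + u²/(4s)`, so the combined kernel is
`2 e^{-2c} e^{-y²} dy`. The sign of `c` decides whether `y` tends to `-∞` or `+∞` as `s → 0`; the
two choices of `c` give two linear equations for the orders `±1/2`. -/
lemma besselInt_half_add {u c : ℝ} (hu : 0 < u) (hc : c = u / 2 ∨ c = -(u / 2)) {l : ℝ}
    (hl : Tendsto gaussPrimitive (if 0 < c then atBot else atTop) (𝓝 l)) :
    besselInt (1 / 2) u + c * besselInt (-1 / 2) u =
      2 * exp (-(2 * c)) * (√π / 2 - l) := by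
  have hcu : c ^ 2 = u ^ 2 / 4 := by rcases hc with rfl | rfl <;> ring
  have i1 := integrableOn_besselKernel (by norm_num : (-1 : ℝ) < 1 / 2) hu
  have i2 := (integrableOn_besselKernel (by norm_num : (-1 : ℝ) < -1 / 2) hu).const_mul c
  have key : ∫ s in Ioi 0, (besselKernel (1 / 2) u s + c * besselKernel (-1 / 2) u s) =
      2 * exp (-(2 * c)) * (√π / 2) - 2 * exp (-(2 * c)) * l := by
    apply integral_Ioi_of_hasDerivAt_of_tendsto_nhdsGT
      (f := fun s => 2 * exp (-(2 * c)) * gaussPrimitive (√s - c * (√s)⁻¹))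
      (f' := fun s => besselKernel (1 / 2) u s + c * besselKernel (-1 / 2) u s) _ _ (i1.add i2)
    · refine (tendsto_gaussPrimitive_atTop.comp ?_).const_mul _
      have h1 : Tendsto (fun s : ℝ => c * (√s)⁻¹) atTop (𝓝 (c * 0)) :=
        (tendsto_inv_atTop_zero.comp tendsto_sqrt_atTop).const_mul c
      simpa only [sub_eq_add_neg] using tendsto_atTop_add_right_of_le' atTop (-1)
        tendsto_sqrt_atTop (by
          have := h1.eventually (gt_mem_nhds (by simp : c * 0 < 1))
          filter_upwards [this] with s hs
          linarith)
    · refine (hl.comp ?_).const_mul _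
      have hs0 : Tendsto (fun s : ℝ => √s) (𝓝[>] 0) (𝓝[>] 0) := by
        refine tendsto_nhdsWithin_iff.mpr ⟨?_, ?_⟩
        · have := continuous_sqrt.tendsto 0
          rw [sqrt_zero] at this
          exact this.mono_left nhdsWithin_le_nhds
        · filter_upwards [self_mem_nhdsWithin] with s hs using sqrt_pos.mpr hs
      have hinv : Tendsto (fun s : ℝ => (√s)⁻¹) (𝓝[>] 0) atTop := tendsto_inv_nhdsGT_zero.comp hs0
      have hs0' := hs0.mono_right nhdsWithin_le_nhds
      split_ifs with h
      · have := hs0'.add_atBot (hinv.const_mul_atTop_of_neg (neg_lt_zero.mpr h))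
        refine this.congr fun s => by ring
      · have hneg : 0 < -c := by rcases hc with rfl | rfl <;> [exact absurd (by positivity) h; linarith]
        refine (hs0'.add_atTop (hinv.const_mul_atTop hneg)).congr fun s => by ring
    · intro s hs
      have hs : 0 < s := hs
      have hq : 0 < √s := sqrt_pos.mpr hs
      have d1 : HasDerivAt (fun s : ℝ => √s) (1 / (2 * √s)) s := hasDerivAt_sqrt hs.ne'
      have d2 : HasDerivAt (fun s : ℝ => √s - c * (√s)⁻¹)
          (1 / (2 * √s) - c * (-(1 / (2 * √s)) / (√s) ^ 2)) s :=
        d1.sub ((d1.inv hq.ne').const_mul c)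
      have d3 := ((hasDerivAt_gaussPrimitive _).comp s d2).const_mul (2 * exp (-(2 * c)))
      refine d3.congr_deriv ?_
      have r1 : s ^ ((1 : ℝ) / 2 - 1) = (√s)⁻¹ := by
        rw [sqrt_eq_rpow, ← rpow_neg hs.le]; norm_num
      have r2 : s ^ ((-1 : ℝ) / 2 - 1) = (√s)⁻¹ * s⁻¹ := by
        rw [show (-1 : ℝ) / 2 - 1 = (1 / 2 - 1) - 1 by norm_num, rpow_sub_one hs.ne', r1]; rfl
      have r3 : exp (-(s + u ^ 2 / (4 * s))) =
          exp (-(2 * c)) * exp (-1 * (√s - c * (√s)⁻¹) ^ 2) := by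
        rw [← exp_add]; congr 1
        have : (√s - c * (√s)⁻¹) ^ 2 = s - 2 * c + u ^ 2 / (4 * s) := by
          have e : (√s - c * (√s)⁻¹) ^ 2 = (√s) ^ 2 - 2 * c * (√s * (√s)⁻¹) + c ^ 2 * ((√s) ^ 2)⁻¹ := by
            ring
          rw [e, sq_sqrt hs.le, mul_inv_cancel₀ hq.ne', hcu]; field_simp
        rw [this]; ring
      simp only [besselKernel, r1, r2, r3]
      have hss : s = √s ^ 2 := (sq_sqrt hs.le).symm
      have : s⁻¹ = (√s ^ 2)⁻¹ := by rw [← hss]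
      rw [this]
      field_simp
      ring
  rw [integral_add i1 i2, integral_const_mul] at key
  simp only [besselInt]; linarith

lemma besselInt_half {u : ℝ} (hu : 0 < u) :
    besselInt (1 / 2) u = √π * exp (-u) ∧ u * besselInt (-1 / 2) u = 2 * √π * exp (-u) := by
  have h1 := besselInt_half_add hu (Or.inl rfl) (l := -(√π / 2)) (by
    rw [if_pos (by positivity)]; exact tendsto_gaussPrimitive_atBot)
  have h2 := besselInt_half_add hu (Or.inr rfl) (l := √π / 2) (by
    rw [if_neg (by linarith)]; exact tendsto_gaussPrimitive_atTop)
  rw [show 2 * (u / 2) = u by ring] at h1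
  constructor <;> linarith

lemma besselInt_eq_besselPoly {u : ℝ} (hu : 0 < u) (k : ℕ) :
    besselInt (k + 1 / 2) u = √π * (1 / 2) ^ k * (besselPoly k).eval u * exp (-u) := by
  obtain ⟨h0, h1⟩ := besselInt_half hu
  induction k using Nat.strong_induction_on with
  | _ k ih =>
  match k with
  | 0 => simp [besselPoly]; simpa using h0
  | 1 =>
    have h := besselInt_add_one (ν := 1 / 2) (by norm_num) hu
    rw [show (1 : ℝ) / 2 - 1 = -1 / 2 by norm_num] at h
    rw [show ((1 : ℕ) : ℝ) + 1 / 2 = 1 / 2 + 1 by norm_num, h, h0]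
    simp [besselPoly]
    linear_combination u / 4 * h1
  | k + 2 =>
    have i0 := ih k (by omega)
    have i1 := ih (k + 1) (by omega)
    have h := besselInt_add_one (ν := (k + 1 : ℕ) + 1 / 2) (by positivity) hu
    rw [show ((k + 1 : ℕ) : ℝ) + 1 / 2 - 1 = k + 1 / 2 by push_cast; ring, i0, i1] at h
    rw [show ((k + 2 : ℕ) : ℝ) + 1 / 2 = (k + 1 : ℕ) + 1 / 2 + 1 by push_cast; ring, h, besselPoly]
    simp
    ring

lemma Gamma_nat_add_half_eq (k : ℕ) :
    Gamma (k + 1 / 2) = √π * (1 / 2) ^ k * (besselPoly k).eval 0 := by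
  rw [besselPoly_eval_zero]
  induction k with
  | zero => simp [oddFactorial]; simpa using Gamma_one_half_eq
  | succ k ih =>
    rw [show ((k + 1 : ℕ) : ℝ) + 1 / 2 = (k + 1 / 2) + 1 by push_cast; ring,
      Gamma_add_one (by positivity), ih, oddFactorial]
    ring

lemma besselInt_div_Gamma {u : ℝ} (hu : 0 ≤ u) (k : ℕ) :
    besselInt ((2 * k + 1) / 2) u / Gamma ((2 * k + 1) / 2) =
      (besselPoly k).eval u * exp (-u) / oddFactorial k := by
  have h2 := oddFactorial_pos k
  have h3 : 0 < √π := sqrt_pos.mpr pi_pos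
  rw [show (2 * (k : ℝ) + 1) / 2 = k + 1 / 2 by ring]
  -- At `u = 0` the integral of order `-1/2` behind the closed form diverges; there both sides equal
  -- 1.
  rcases hu.eq_or_lt with rfl | hu
  · rw [besselInt_zero_right (by positivity), div_self (Gamma_pos_of_pos (by positivity)).ne',
      besselPoly_eval_zero]
    simp [h2.ne']
  · rw [besselInt_eq_besselPoly hu, Gamma_nat_add_half_eq, besselPoly_eval_zero]
    field_simp

end StudentKL

/-! ### Characteristic functions and the law of the half-sum -/

namespace StudentKL

open Set Filter Topology Real
open scoped RealInnerProductSpace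

variable {n : ℕ}

/-- The normalising constant of `density`. -/
def normConst (n : ℕ) (p : ℝ) : ℝ :=
  Gamma ((p + n) / 2) / (π ^ ((n : ℝ) / 2) * Gamma (p / 2))

lemma density_eq (p : ℝ) (x : EuclideanSpace ℝ (Fin n)) :
    density n p x = normConst n p * (1 + ‖x‖ ^ 2) ^ (-((p + n) / 2)) := rfl

lemma normConst_pos {p : ℝ} (hp : 0 < p) : 0 < normConst n p :=
  div_pos (Gamma_pos_of_pos (by positivity))
    (mul_pos (by positivity) (Gamma_pos_of_pos (by positivity)))

lemma density_pos {p : ℝ} (hp : 0 < p) (x : EuclideanSpace ℝ (Fin n)) : 0 < density n p x := by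
  rw [density_eq]; have := normConst_pos (n := n) hp; positivity

lemma continuous_density (p : ℝ) : Continuous (density n p) := by
  refine continuous_const.mul (Continuous.rpow_const (by fun_prop) fun x => Or.inl ?_)
  positivity

lemma integrable_rpow_one_add_norm_sq {c : ℝ} (hc : (n : ℝ) / 2 < c) :
    Integrable fun x : EuclideanSpace ℝ (Fin n) => (1 + ‖x‖ ^ 2) ^ (-c) := by
  have := integrable_rpow_neg_one_add_norm_sq (E := EuclideanSpace ℝ (Fin n)) (μ := volume)
    (r := 2 * c) (by simp; linarith)
  simpa only [show -(2 * c) / 2 = -c by ring] using this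

lemma integrable_density {p : ℝ} (hp : 0 < p) : Integrable (density n p) :=
  (integrable_rpow_one_add_norm_sq (by linarith)).const_mul _

/-- The joint integrand of the Gaussian scale mixture representation. -/
def mixtureKernel (c : ℝ) (t x : EuclideanSpace ℝ (Fin n)) (s : ℝ) : ℂ :=
  ((s ^ (c - 1) * exp (-((1 + ‖x‖ ^ 2) * s)) : ℝ) : ℂ) * Complex.exp (⟪x, t⟫ * Complex.I)

lemma integral_mixtureKernel_snd {c : ℝ} (hc : 0 < c) (t x : EuclideanSpace ℝ (Fin n)) :
    ∫ s in Ioi 0, mixtureKernel c t x s =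
      ((Gamma c * (1 + ‖x‖ ^ 2) ^ (-c) : ℝ) : ℂ) * Complex.exp (⟪x, t⟫ * Complex.I) := by
  simp only [mixtureKernel]
  rw [integral_mul_const, integral_complex_ofReal,
    integral_rpow_mul_exp_neg_mul_Ioi hc (by positivity)]
  congr 2
  rw [one_div, inv_rpow (by positivity), rpow_neg (by positivity), mul_comm]

lemma integral_norm_mixtureKernel {c : ℝ} (hc : 0 < c) (t x : EuclideanSpace ℝ (Fin n)) :
    ∫ s in Ioi 0, ‖mixtureKernel c t x s‖ = Gamma c * (1 + ‖x‖ ^ 2) ^ (-c) := by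
  have : ∀ s ∈ Ioi (0 : ℝ), ‖mixtureKernel c t x s‖ =
      s ^ (c - 1) * exp (-((1 + ‖x‖ ^ 2) * s)) := fun s hs => by
    have hs : 0 < s := hs
    rw [mixtureKernel, norm_mul, Complex.norm_exp_ofReal_mul_I, mul_one, Complex.norm_real,
      norm_of_nonneg (by positivity)]
  rw [setIntegral_congr_fun measurableSet_Ioi this,
    integral_rpow_mul_exp_neg_mul_Ioi hc (by positivity), one_div, inv_rpow (by positivity),
    rpow_neg (by positivity), mul_comm]

/-- The Gaussian Fourier transform contributes `(π/s)^{n/2}`, which lowers the exponent `(p+n)/2 -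
1` to `p/2 - 1`: the Bessel order does not depend on the dimension. -/
lemma integral_mixtureKernel_fst (p : ℝ) {s : ℝ} (hs : 0 < s) (t : EuclideanSpace ℝ (Fin n)) :
    ∫ x, mixtureKernel ((p + n) / 2) t x s =
      ((π ^ ((n : ℝ) / 2) * besselKernel (p / 2) ‖t‖ s : ℝ) : ℂ) := by
  have h1 : ∀ x : EuclideanSpace ℝ (Fin n), mixtureKernel ((p + n) / 2) t x s =
      ((s ^ ((p + n) / 2 - 1) * exp (-s) : ℝ) : ℂ) *
        Complex.exp (-(s : ℂ) * ‖x‖ ^ 2 + Complex.I * ⟪t, x⟫) := fun x => by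
    rw [mixtureKernel, real_inner_comm, Complex.exp_add,
      show -((1 + ‖x‖ ^ 2) * s) = -s + -(s * ‖x‖ ^ 2) by ring, exp_add]
    push_cast
    rw [neg_mul, mul_comm Complex.I]
    ring
  simp_rw [h1]
  rw [integral_const_mul,
    GaussianFourier.integral_cexp_neg_mul_sq_norm_add_of_euclideanSpace (by simpa using hs),
    Fintype.card_fin]
  have h2 : ((π : ℂ) / s) ^ ((n : ℂ) / 2) = (((π / s) ^ ((n : ℝ) / 2) : ℝ) : ℂ) := by
    rw [Complex.ofReal_cpow (by positivity)]; push_cast; rfl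
  have h3 : Complex.I ^ 2 * (‖t‖ : ℂ) ^ 2 / (4 * s) = ((-(‖t‖ ^ 2 / (4 * s)) : ℝ) : ℂ) := by
    rw [Complex.I_sq]; push_cast; ring
  rw [h2, h3, ← Complex.ofReal_exp, ← Complex.ofReal_mul, ← Complex.ofReal_mul]
  congr 1
  rw [besselKernel, div_rpow pi_pos.le hs.le, neg_add, exp_add,
    show (p + n) / 2 - 1 = (p / 2 - 1) + n / 2 by ring, rpow_add hs]
  have : 0 < s ^ ((n : ℝ) / 2) := by positivity
  field_simp

lemma integrable_mixtureKernel {p : ℝ} (hp : 0 < p) (t : EuclideanSpace ℝ (Fin n)) :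
    Integrable (fun z : EuclideanSpace ℝ (Fin n) × ℝ => mixtureKernel ((p + n) / 2) t z.1 z.2)
      (volume.prod (volume.restrict (Ioi 0))) := by
  have hc : 0 < (p + n) / 2 := by positivity
  have hm : Measurable fun z : EuclideanSpace ℝ (Fin n) × ℝ =>
      mixtureKernel ((p + n) / 2) t z.1 z.2 := by
    unfold mixtureKernel; fun_prop
  rw [integrable_prod_iff hm.aestronglyMeasurable]
  constructor
  · refine Eventually.of_forall fun x => ?_
    -- A non-integrable function has integral 0 by convention, but the value computed for this
    -- integral is nonzero.
    by_contra h
    have h0 := integral_undef h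
    have h1 := integral_mixtureKernel_snd hc t x
    rw [h0] at h1
    refine mul_ne_zero ?_ (Complex.exp_ne_zero _) h1.symm
    have := Gamma_pos_of_pos hc
    exact Complex.ofReal_ne_zero.mpr (by positivity)
  · simp_rw [integral_norm_mixtureKernel hc]
    exact (integrable_rpow_one_add_norm_sq (by linarith)).const_mul _

lemma integral_density_mul_cexp {p : ℝ} (hp : 0 < p) (t : EuclideanSpace ℝ (Fin n)) :
    ∫ x, (density n p x : ℂ) * Complex.exp (⟪x, t⟫ * Complex.I) =
      ((besselInt (p / 2) ‖t‖ / Gamma (p / 2) : ℝ) : ℂ) := by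
  have hc : 0 < (p + n) / 2 := by positivity
  have hG := Gamma_pos_of_pos hc
  have hG' := Gamma_pos_of_pos (half_pos hp)
  have hswap := integral_integral_swap
    (f := fun x s => mixtureKernel ((p + n) / 2) t x s) (integrable_mixtureKernel hp t)
  simp_rw [integral_mixtureKernel_snd hc t] at hswap
  rw [setIntegral_congr_fun measurableSet_Ioi
    (fun s hs => integral_mixtureKernel_fst p hs t), integral_complex_ofReal,
    integral_const_mul] at hswap
  have h1 : ∀ x : EuclideanSpace ℝ (Fin n),
      (density n p x : ℂ) * Complex.exp (⟪x, t⟫ * Complex.I) =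
      ((π ^ ((n : ℝ) / 2) * Gamma (p / 2) : ℝ) : ℂ)⁻¹ *
      (((Gamma ((p + n) / 2) * (1 + ‖x‖ ^ 2) ^ (-((p + n) / 2)) : ℝ) : ℂ) *
        Complex.exp (⟪x, t⟫ * Complex.I)) := fun x => by
    rw [← mul_assoc, ← Complex.ofReal_inv, ← Complex.ofReal_mul]
    congr 2
    rw [density]; ring
  simp_rw [h1]
  rw [integral_const_mul, hswap, ← Complex.ofReal_inv, ← Complex.ofReal_mul, besselInt]
  congr 1
  have : 0 < π ^ ((n : ℝ) / 2) := by positivity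
  field_simp

lemma integral_density {p : ℝ} (hp : 0 < p) : ∫ x, density n p x = 1 := by
  have h := integral_density_mul_cexp (n := n) hp 0
  simp only [inner_zero_right, Complex.ofReal_zero, zero_mul, Complex.exp_zero, mul_one,
    norm_zero] at h
  rw [besselInt_zero_right (half_pos hp), div_self (Gamma_pos_of_pos (half_pos hp)).ne',
    integral_complex_ofReal] at h
  exact_mod_cast h

lemma charFun_withDensity_ofReal {f : EuclideanSpace ℝ (Fin n) → ℝ} (hf : Measurable f)
    (hf0 : ∀ x, 0 ≤ f x) (t : EuclideanSpace ℝ (Fin n)) :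
    charFun (volume.withDensity fun x => ENNReal.ofReal (f x)) t =
      ∫ x, (f x : ℂ) * Complex.exp (⟪x, t⟫ * Complex.I) := by
  rw [charFun_apply, integral_withDensity_eq_integral_toReal_smul (by fun_prop)
    (Eventually.of_forall fun x => ENNReal.ofReal_lt_top)]
  refine integral_congr_ae (Eventually.of_forall fun x => ?_)
  simp [ENNReal.toReal_ofReal (hf0 x)]

lemma charFun_law {p : ℝ} (hp : 0 < p) (t : EuclideanSpace ℝ (Fin n)) :
    charFun (law n p) t = ((besselInt (p / 2) ‖t‖ / Gamma (p / 2) : ℝ) : ℂ) := by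
  rw [law, charFun_withDensity_ofReal (continuous_density p).measurable
    (fun x => (density_pos hp x).le), integral_density_mul_cexp hp]

lemma charFun_law_odd (k : ℕ) (t : EuclideanSpace ℝ (Fin n)) :
    charFun (law n (2 * k + 1)) t =
      (((besselPoly k).eval ‖t‖ * exp (-‖t‖) / oddFactorial k : ℝ) : ℂ) := by
  rw [charFun_law (by positivity), besselInt_div_Gamma (norm_nonneg t)]

/-- The half-sum of independent Student vectors with `2k + 1` and `2l + 1` degrees of freedom is a
mixture of Student vectors with odd degrees of freedom. -/
theorem exists_mixture {Ω : Type*} [MeasurableSpace Ω] {P : Measure Ω} [IsProbabilityMeasure P]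
    {k l : ℕ} {X Y : Ω → EuclideanSpace ℝ (Fin n)}
    (hX : HasLaw X (law n (2 * k + 1)) P) (hY : HasLaw Y (law n (2 * l + 1)) P)
    (hXY : IndepFun X Y P) :
    ∃ α : ℕ → ℝ, (∀ i, 0 ≤ α i) ∧ ∑ i ∈ Finset.range (k + l + 1), α i = 1 ∧
      P.map (fun ω => (1 / 2 : ℝ) • (X ω + Y ω)) = volume.withDensity fun x =>
        ENNReal.ofReal (∑ i ∈ Finset.range (k + l + 1), α i * density n (2 * i + 1) x) := by
  obtain ⟨c, hc, hsum⟩ := exists_coeff_of_mem_besselCone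
    (besselPoly_comp_mul_comp_mem_besselCone (a := 1 / 2) (b := 1 / 2) (by norm_num) (by norm_num)
      (by norm_num) k l)
  have heval : ∀ u : ℝ, (besselPoly k).eval (1 / 2 * u) * (besselPoly l).eval (1 / 2 * u) =
      ∑ i ∈ Finset.range (k + l + 1), c i * (besselPoly i).eval u := fun u => by
    have := congrArg (Polynomial.eval u) hsum
    simpa [Polynomial.eval_finsetSum] using this
  have hk := oddFactorial_pos k
  have hl := oddFactorial_pos l
  -- The factors `oddFactorial` convert between `θ_i` and the transform of `g_{2i+1}`, normalised to
  -- 1 at the origin. Evaluating the polynomial identity at 0 then gives total mass 1.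
  set α : ℕ → ℝ := fun i => c i * oddFactorial i / (oddFactorial k * oddFactorial l) with hα
  have hα0 : ∀ i, 0 ≤ α i := fun i => by
    have := oddFactorial_pos i; have := hc i; positivity
  refine ⟨α, hα0, ?_, ?_⟩
  · have := heval 0
    simp only [mul_zero, besselPoly_eval_zero] at this
    rw [hα, ← Finset.sum_div, ← this, div_self (by positivity)]
  have hfm : Measurable fun x : EuclideanSpace ℝ (Fin n) =>
      ∑ i ∈ Finset.range (k + l + 1), α i * density n (2 * i + 1) x :=
    Finset.measurable_sum _ fun i _ => ((continuous_density _).measurable.const_mul _)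
  have hf0 : ∀ x : EuclideanSpace ℝ (Fin n),
      0 ≤ ∑ i ∈ Finset.range (k + l + 1), α i * density n (2 * i + 1) x := fun x =>
    Finset.sum_nonneg fun i _ => mul_nonneg (hα0 i) (density_pos (by positivity) x).le
  have hfi : Integrable fun x : EuclideanSpace ℝ (Fin n) =>
      ∑ i ∈ Finset.range (k + l + 1), α i * density n (2 * i + 1) x :=
    integrable_finsetSum _ fun i _ => (integrable_density (by positivity)).const_mul _
  have : IsFiniteMeasure (volume.withDensity fun x : EuclideanSpace ℝ (Fin n) =>
      ENNReal.ofReal (∑ i ∈ Finset.range (k + l + 1), α i * density n (2 * i + 1) x)) :=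
    isFiniteMeasure_withDensity_ofReal hfi.2
  refine Measure.ext_of_charFun (funext fun t => ?_)
  rw [charFun_withDensity_ofReal hfm hf0, charFun_map_smul_comp,
    hXY.charFun_map_fun_add_eq_mul hX.aemeasurable hY.aemeasurable]
  rw [Pi.mul_apply, hX.map_eq, hY.map_eq, charFun_law_odd, charFun_law_odd, norm_smul]
  have hexp : ∀ i : ℕ, Integrable fun x : EuclideanSpace ℝ (Fin n) =>
      (density n (2 * i + 1) x : ℂ) * Complex.exp (⟪x, t⟫ * Complex.I) := fun i => by
    refine (integrable_density (by positivity)).ofReal.mul_bdd (c := 1) ?_ ?_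
    · exact (by fun_prop : Continuous fun x : EuclideanSpace ℝ (Fin n) =>
        Complex.exp (⟪x, t⟫ * Complex.I)).aestronglyMeasurable
    · exact Eventually.of_forall fun x => (Complex.norm_exp_ofReal_mul_I _).le
  have h1 : ∀ x : EuclideanSpace ℝ (Fin n),
      ((∑ i ∈ Finset.range (k + l + 1), α i * density n (2 * i + 1) x : ℝ) : ℂ) *
        Complex.exp (⟪x, t⟫ * Complex.I) = ∑ i ∈ Finset.range (k + l + 1), (α i : ℂ) *
        ((density n (2 * i + 1) x : ℂ) * Complex.exp (⟪x, t⟫ * Complex.I)) := fun x => by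
    push_cast
    rw [Finset.sum_mul]
    exact Finset.sum_congr rfl fun i _ => by ring
  simp_rw [h1]
  rw [integral_finsetSum _ fun i _ => (hexp i).const_mul _]
  have h2 : ∀ i ∈ Finset.range (k + l + 1),
      ∫ x : EuclideanSpace ℝ (Fin n), (α i : ℂ) *
        ((density n (2 * i + 1) x : ℂ) * Complex.exp (⟪x, t⟫ * Complex.I)) =
      ((c i * (besselPoly i).eval ‖t‖ * (exp (-‖t‖) / (oddFactorial k * oddFactorial l)) : ℝ) : ℂ)
      := fun i _ => by
    rw [integral_const_mul, integral_density_mul_cexp (by positivity),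
      besselInt_div_Gamma (norm_nonneg t), ← Complex.ofReal_mul, hα]
    congr 1
    have := oddFactorial_pos i
    field_simp
  rw [Finset.sum_congr rfl h2, ← Complex.ofReal_sum, ← Finset.sum_mul, ← heval,
    ← Complex.ofReal_mul]
  on_goal 2 => exact hX.aemeasurable.add hY.aemeasurable
  congr 1
  have : ‖(1 / 2 : ℝ)‖ = 1 / 2 := by norm_num
  rw [this, show exp (-‖t‖) = exp (-(1 / 2 * ‖t‖)) * exp (-(1 / 2 * ‖t‖)) by
    rw [← exp_add]; congr 1; ring]
  field_simp

end StudentKL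

namespace StudentKL

/-! ### The digamma function and the range of `Delta` -/

section Digamma

open Set Filter Topology Real

lemma hasDerivAt_log_Gamma {s : ℝ} (hs : 0 < s) :
    HasDerivAt (fun s => log (Gamma s)) (psi s) s := by
  have h1 : DifferentiableAt ℝ Gamma s :=
    differentiableOn_Gamma_Ioi.differentiableAt (Ioi_mem_nhds hs)
  exact (h1.log (Gamma_pos_of_pos hs).ne').hasDerivAt

lemma psi_add_one {s : ℝ} (hs : 0 < s) : psi (s + 1) = psi s + 1 / s := by
  have h1 : HasDerivAt (fun s => log (Gamma (s + 1))) (psi (s + 1)) s :=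
    (hasDerivAt_log_Gamma (by linarith : 0 < s + 1)).comp_add_const s 1
  have h2 : HasDerivAt (fun s => log (Gamma s) + log s) (psi s + s⁻¹) s :=
    (hasDerivAt_log_Gamma hs).add (hasDerivAt_log hs.ne')
  rw [one_div]
  refine h1.unique (h2.congr_of_eventuallyEq ?_)
  filter_upwards [Ioi_mem_nhds hs] with t ht
  have ht : 0 < t := ht
  rw [Gamma_add_one ht.ne', log_mul ht.ne' (Gamma_pos_of_pos ht).ne', add_comm]

lemma monotoneOn_psi : MonotoneOn psi (Ioi 0) :=
  convexOn_log_Gamma.monotoneOn_deriv fun _ hs => (hasDerivAt_log_Gamma hs).differentiableAt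

lemma psi_add_nat_le {s : ℝ} (hs : 0 < s) (m : ℕ) : psi (s + m) ≤ psi s + m / s := by
  induction m with
  | zero => simp
  | succ m ih =>
    have h1 : psi (s + m + 1) = _ := psi_add_one (by positivity : 0 < s + m)
    have h2 : 1 / (s + m) ≤ 1 / s := one_div_le_one_div_of_le hs (by simp)
    push_cast
    rw [← add_assoc, h1, add_div]
    linarith

/-- By monotonicity the shift `n/2` may be enlarged to the integer `n`, and each unit step of the
functional equation adds at most `1/(p/2)`. -/
lemma Delta_le {n : ℕ} {p : ℝ} (hp : 0 < p) : Delta n p ≤ 2 * n / p := by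
  have h1 := psi_add_nat_le (half_pos hp) n
  have h2 : psi ((p + n) / 2) ≤ psi (p / 2 + n) :=
    monotoneOn_psi (show 0 < (p + n) / 2 by positivity) (show 0 < p / 2 + n by positivity)
      (by have : (0 : ℝ) ≤ n := by positivity
          linarith)
  have h3 : (n : ℝ) / (p / 2) = 2 * n / p := by field_simp
  rw [Delta]; linarith

/-- The term `2/p` is the pole of `psi` at 0, extracted by one functional equation; the rest is
bounded by monotonicity. -/
lemma le_Delta {n : ℕ} (hn : 0 < n) {p : ℝ} (hp : 0 < p) (hp2 : p ≤ 2) :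
    psi (n / 2) - psi 2 + 2 / p ≤ Delta n p := by
  have hn' : (0 : ℝ) < n := by exact_mod_cast hn
  have h1 : psi (n / 2) ≤ psi ((p + n) / 2) :=
    monotoneOn_psi (show 0 < (n : ℝ) / 2 by positivity) (show 0 < (p + n) / 2 by positivity)
      (by linarith)
  have h2 := psi_add_one (half_pos hp)
  have h3 : psi (p / 2 + 1) ≤ psi 2 :=
    monotoneOn_psi (show 0 < p / 2 + 1 by positivity) (show (0 : ℝ) < 2 by positivity)
      (by linarith)
  have h4 : 1 / (p / 2) = 2 / p := by field_simp
  rw [Delta]; linarith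

lemma hasDerivAt_log_Gamma_sub (n : ℕ) {p : ℝ} (hp : 0 < p) :
    HasDerivAt (fun q : ℝ => log (Gamma ((q + n) / 2)) - log (Gamma (q / 2)))
      (Delta n p / 2) p := by
  have h1 : HasDerivAt (fun q : ℝ => (q + n) / 2) (1 / 2) p :=
    ((hasDerivAt_id p).add_const _).div_const 2
  have h2 : HasDerivAt (fun q : ℝ => q / 2) (1 / 2) p := (hasDerivAt_id p).div_const 2
  have h3 := ((hasDerivAt_log_Gamma (by positivity : 0 < (p + n) / 2)).comp p h1).sub
    ((hasDerivAt_log_Gamma (half_pos hp)).comp p h2)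
  refine h3.congr_deriv ?_
  rw [Delta]; ring

/-- `Delta n` is twice a derivative, so Darboux's theorem gives intermediate values without
continuity of `psi`. -/
lemma exists_Delta_eq {n : ℕ} (hn : 0 < n) {m : ℝ} (hm : 0 < m) : ∃ p > 0, Delta n p = m := by
  have hn' : (0 : ℝ) < n := by exact_mod_cast hn
  obtain ⟨K, hK0, hK⟩ : ∃ K : ℝ, 1 < K ∧ m - psi (n / 2) + psi 2 < K :=
    ⟨max 1 (m - psi (n / 2) + psi 2) + 1, by linarith [le_max_left 1 (m - psi (n / 2) + psi 2)],
      by linarith [le_max_right 1 (m - psi (n / 2) + psi 2)]⟩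
  -- `K > 1` gives `a ≤ 2`, as `le_Delta` requires, and `2/a = K` exceeds what is needed for `Delta
  -- n a > m`. In `b`, the term `4n/m` forces `Delta n b < m` and the summand `a` ensures `a < b`.
  set a : ℝ := 2 / K with ha
  set b : ℝ := 4 * n / m + a with hb
  have hK' : 0 < K := by linarith
  have ha0 : 0 < a := by positivity
  have ha2 : a ≤ 2 := by rw [ha, div_le_iff₀ hK']; linarith
  have hb0 : 0 < 4 * n / m := by positivity
  have hma : m < Delta n a := by
    have := le_Delta hn ha0 ha2
    rw [ha, show 2 / (2 / K) = K by field_simp] at this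
    linarith
  have hmb : Delta n b < m := by
    refine (Delta_le (by positivity)).trans_lt ?_
    rw [div_lt_iff₀ (by positivity), hb, mul_add, show m * (4 * n / m) = 4 * n by field_simp]
    have : 0 < m * a := by positivity
    linarith
  obtain ⟨c, hc, hc'⟩ := exists_hasDerivWithinAt_eq_of_lt_of_gt (a := a) (b := b) (by linarith)
    (f := fun q : ℝ => log (Gamma ((q + n) / 2)) - log (Gamma (q / 2)))
    (f' := fun q => Delta n q / 2) (m := m / 2)
    (fun x hx => (hasDerivAt_log_Gamma_sub n (ha0.trans_le hx.1)).hasDerivWithinAt)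
    (by linarith) (by linarith)
  exact ⟨c, ha0.trans hc.1, by linarith⟩

end Digamma

/-! ### The logarithmic moment and monotonicity of `Delta` -/

section LogMoment

open Set Filter Topology Real

variable {n : ℕ}

lemma logMoment_nonneg (x : EuclideanSpace ℝ (Fin n)) : 0 ≤ logMoment x :=
  log_nonneg (by simp)

lemma continuous_logMoment : Continuous (logMoment (n := n)) :=
  Continuous.log (by fun_prop) fun x => by positivity

lemma logMoment_le {ε : ℝ} (hε : 0 < ε) (x : EuclideanSpace ℝ (Fin n)) :
    logMoment x ≤ (1 + ‖x‖ ^ 2) ^ ε / ε :=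
  log_le_rpow_div (by positivity) hε

lemma rpow_one_add_norm_sq_eq (c : ℝ) (x : EuclideanSpace ℝ (Fin n)) :
    (1 + ‖x‖ ^ 2) ^ c = exp (logMoment x * c) := by
  rw [logMoment, rpow_def_of_pos (by positivity)]

lemma integrable_logMoment_mul_rpow {c : ℝ} (hc : (n : ℝ) / 2 < c) :
    Integrable fun x : EuclideanSpace ℝ (Fin n) => logMoment x * (1 + ‖x‖ ^ 2) ^ (-c) := by
  -- Half of the spare decay absorbs the logarithm; the other half keeps the power integrable.
  set ε := (c - n / 2) / 2 with hε
  have hε0 : 0 < ε := by rw [hε]; linarith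
  refine ((integrable_rpow_one_add_norm_sq (c := c - ε) (by rw [hε]; linarith)).div_const ε).mono'
    ?_ (Eventually.of_forall fun x => ?_)
  · exact (continuous_logMoment.mul (Continuous.rpow_const (by fun_prop)
      fun x => Or.inl (by positivity))).aestronglyMeasurable
  · rw [norm_of_nonneg (mul_nonneg (logMoment_nonneg x) (by positivity))]
    calc _ ≤ (1 + ‖x‖ ^ 2) ^ ε / ε * (1 + ‖x‖ ^ 2) ^ (-c) := by
          gcongr; exact logMoment_le hε0 x
      _ = _ := by
          rw [div_mul_eq_mul_div, ← rpow_add (by positivity)]; congr 2; ring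

lemma finiteExpect_density_logMoment {p : ℝ} (hp : 0 < p) :
    FiniteExpect (density n p) logMoment := by
  unfold FiniteExpect
  refine ((integrable_logMoment_mul_rpow (n := n) (c := (p + n) / 2) (by linarith)).const_mul
    (normConst n p)).congr (Eventually.of_forall fun x => ?_)
  simp only [density_eq]; ring

/-- Differentiation under the integral; for `q > p/2` the integrand's derivative is dominated by the
integrable function with `p/2` in the exponent. -/
lemma hasDerivAt_integral_rpow {p : ℝ} (hp : 0 < p) :
    HasDerivAt (fun q : ℝ => ∫ x : EuclideanSpace ℝ (Fin n), (1 + ‖x‖ ^ 2) ^ (-((q + n) / 2)))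
      (∫ x : EuclideanSpace ℝ (Fin n),
        -(1 / 2) * (logMoment x * (1 + ‖x‖ ^ 2) ^ (-((p + n) / 2)))) p := by
  have hcont : ∀ c : ℝ, Continuous fun x : EuclideanSpace ℝ (Fin n) => (1 + ‖x‖ ^ 2) ^ c :=
    fun c => Continuous.rpow_const (by fun_prop) fun x => Or.inl (by positivity)
  refine (hasDerivAt_integral_of_dominated_loc_of_deriv_le (s := Ioi (p / 2))
    (Ioi_mem_nhds (half_lt_self hp))
    (F := fun (q : ℝ) (x : EuclideanSpace ℝ (Fin n)) => (1 + ‖x‖ ^ 2) ^ (-((q + n) / 2)))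
    (F' := fun (q : ℝ) (x : EuclideanSpace ℝ (Fin n)) =>
      -(1 / 2) * (logMoment x * (1 + ‖x‖ ^ 2) ^ (-((q + n) / 2))))
    (bound := fun x => logMoment x * (1 + ‖x‖ ^ 2) ^ (-((p / 2 + n) / 2)))
    (Eventually.of_forall fun q => (hcont _).aestronglyMeasurable)
    (integrable_rpow_one_add_norm_sq (by linarith)) ?_ ?_
    (integrable_logMoment_mul_rpow (by linarith)) ?_).2
  · exact (continuous_const.mul (continuous_logMoment.mul (hcont _))).aestronglyMeasurable
  · refine Eventually.of_forall fun x q hq => ?_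
    have hq : p / 2 < q := hq
    have hL := logMoment_nonneg x
    rw [norm_mul, norm_of_nonneg (mul_nonneg hL (by positivity))]
    have h1 : (1 + ‖x‖ ^ 2) ^ (-((q + n) / 2)) ≤ (1 + ‖x‖ ^ 2) ^ (-((p / 2 + n) / 2)) :=
      rpow_le_rpow_of_exponent_le (by simp) (by linarith)
    have h2 : ‖-(1 / 2 : ℝ)‖ = 1 / 2 := by norm_num
    have h3 : logMoment x * (1 + ‖x‖ ^ 2) ^ (-((q + n) / 2)) ≤
      logMoment x * (1 + ‖x‖ ^ 2) ^ (-((p / 2 + n) / 2)) := by gcongr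
    have h4 : 0 ≤ logMoment x * (1 + ‖x‖ ^ 2) ^ (-((q + n) / 2)) :=
      mul_nonneg hL (by positivity)
    rw [h2]; linarith
  · refine Eventually.of_forall fun x q _ => ?_
    simp only [rpow_one_add_norm_sq_eq]
    have h1 : HasDerivAt (fun q : ℝ => logMoment x * -((q + n) / 2)) (logMoment x * -(1 / 2)) q :=
      ((((hasDerivAt_id q).add_const _).div_const 2).neg).const_mul _
    refine h1.exp.congr_deriv ?_
    ring

lemma integral_rpow_one_add_norm_sq {p : ℝ} (hp : 0 < p) :
    ∫ x : EuclideanSpace ℝ (Fin n), (1 + ‖x‖ ^ 2) ^ (-((p + n) / 2)) = (normConst n p)⁻¹ := by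
  have h := integral_density (n := n) hp
  simp only [density_eq, integral_const_mul] at h
  exact eq_inv_of_mul_eq_one_right h

lemma log_normConst {p : ℝ} (hp : 0 < p) : log (normConst n p) =
    log (Gamma ((p + n) / 2)) - log (Gamma (p / 2)) - n / 2 * log π := by
  have h1 := Gamma_pos_of_pos (by positivity : 0 < (p + n) / 2)
  have h2 := Gamma_pos_of_pos (half_pos hp)
  rw [normConst, log_div h1.ne' (by positivity), log_mul (by positivity) h2.ne', log_rpow pi_pos]
  ring

/-- The logarithmic moment of a Student law. -/
theorem expect_density_logMoment {p : ℝ} (hp : 0 < p) :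
    expect (density n p) logMoment = Delta n p := by
  have hc := normConst_pos (n := n) hp
  have h1 := hasDerivAt_integral_rpow (n := n) hp
  rw [integral_const_mul] at h1
  have h2 : HasDerivAt (fun q : ℝ => exp (-(log (Gamma ((q + n) / 2)) - log (Gamma (q / 2))
      - n / 2 * log π))) ((normConst n p)⁻¹ * -(Delta n p / 2)) p := by
    refine ((hasDerivAt_log_Gamma_sub n hp).sub_const _).neg.exp.congr_deriv ?_
    simp only [Pi.neg_apply]
    rw [← log_normConst hp, exp_neg, exp_log hc]
  have h3 := h1.unique (h2.congr_of_eventuallyEq (by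
    filter_upwards [Ioi_mem_nhds hp] with q hq
    rw [integral_rpow_one_add_norm_sq hq, ← log_normConst hq, exp_neg, exp_log (normConst_pos hq)]))
  have h4 : expect (density n p) logMoment = normConst n p *
      ∫ x : EuclideanSpace ℝ (Fin n), logMoment x * (1 + ‖x‖ ^ 2) ^ (-((p + n) / 2)) := by
    rw [expect, ← integral_const_mul]
    refine integral_congr_ae (Eventually.of_forall fun x => ?_)
    simp only [density_eq]; ring
  rw [h4]
  have h5 : normConst n p * (normConst n p)⁻¹ = 1 := mul_inv_cancel₀ hc.ne'
  linear_combination -2 * normConst n p * h3 + Delta n p * h5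

lemma exists_logMoment_ne (hn : 0 < n) (l : ℝ) :
    ∃ x : EuclideanSpace ℝ (Fin n), logMoment x ≠ l := by
  by_cases hl : l = 0
  · refine ⟨EuclideanSpace.single ⟨0, hn⟩ 1, ?_⟩
    rw [logMoment, hl, PiLp.norm_single]
    have : 0 < log (1 + ‖(1 : ℝ)‖ ^ 2) := log_pos (by norm_num)
    exact this.ne'
  · exact ⟨0, by simpa [logMoment] using Ne.symm hl⟩

/-- Monotone likelihood ratio: `g_q / g_p` decreases in `L = log(1+|x|²)` and equals 1 at `L = l`.
Hence `(L - l)(g_p - g_q) ≥ 0`, strictly off `L = l`. Both densities have mass 1, so `l` drops out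
and the integral is `Delta n p - Delta n q`. -/
lemma strictAntiOn_Delta (hn : 0 < n) : StrictAntiOn (Delta n) (Ioi 0) := by
  intro p hp q hq hpq
  have hp : 0 < p := hp
  have hq : 0 < q := hq
  rw [← expect_density_logMoment hp, ← expect_density_logMoment hq]
  have hcp := normConst_pos (n := n) hp
  have hcq := normConst_pos (n := n) hq
  set δ := (q - p) / 2 with hδ
  have hδ0 : 0 < δ := by rw [hδ]; linarith
  set l := (log (normConst n q) - log (normConst n p)) / δ with hl
  have hratio : ∀ x : EuclideanSpace ℝ (Fin n),
      density n q x = density n p x * exp (δ * (l - logMoment x)) := fun x => by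
    rw [mul_sub, hl, mul_div_cancel₀ _ hδ0.ne', density_eq, density_eq, rpow_one_add_norm_sq_eq,
      rpow_one_add_norm_sq_eq, exp_sub, exp_sub, exp_log hcq, exp_log hcp,
      show logMoment x * -((q + n) / 2) = logMoment x * -((p + n) / 2) - δ * logMoment x by
        rw [hδ]; ring, exp_sub]
    field_simp
  set h : EuclideanSpace ℝ (Fin n) → ℝ :=
    fun x => (logMoment x - l) * (density n p x - density n q x) with hh
  have hpos : ∀ x, logMoment x ≠ l → 0 < h x := fun x hx => by
    have hd := density_pos hp x
    simp only [hh]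
    rw [hratio x, ← mul_one_sub]
    rcases lt_or_gt_of_ne hx with hx | hx
    · have : 1 < exp (δ * (l - logMoment x)) :=
        one_lt_exp_iff.mpr (mul_pos hδ0 (by linarith))
      exact mul_pos_of_neg_of_neg (by linarith) (mul_neg_of_pos_of_neg hd (by linarith))
    · have : exp (δ * (l - logMoment x)) < 1 :=
        exp_lt_one_iff.mpr (mul_neg_of_pos_of_neg hδ0 (by linarith))
      exact mul_pos (by linarith) (mul_pos hd (by linarith))
  have hnonneg : 0 ≤ h := fun x => by
    by_cases hx : logMoment x = l
    · simp [hh, hx]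
    · exact (hpos x hx).le
  have hcont : Continuous h := (continuous_logMoment.sub continuous_const).mul
    ((continuous_density p).sub (continuous_density q))
  have ip : Integrable fun x => logMoment x * density n p x := finiteExpect_density_logMoment hp
  have iq : Integrable fun x => logMoment x * density n q x := finiteExpect_density_logMoment hq
  have id := ((integrable_density (n := n) hp).sub (integrable_density (n := n) hq)).const_mul l
  have ipq : Integrable fun x => logMoment x * density n p x - logMoment x * density n q x :=
    ip.sub iq
  have heq : h = fun x => (logMoment x * density n p x - logMoment x * density n q x) -
      l * (density n p - density n q) x := by
    ext x; simp only [hh, Pi.sub_apply]; ring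
  have hint : Integrable h := by rw [heq]; exact ipq.sub id
  obtain ⟨x, hx⟩ := exists_logMoment_ne hn l
  have hI := integral_pos_of_integrable_nonneg_nonzero hcont hint hnonneg (hpos x hx).ne'
  rw [heq, integral_sub ipq id, integral_sub ip iq, integral_const_mul,
    integral_sub' (integrable_density hp) (integrable_density hq), integral_density hp,
    integral_density hq] at hI
  simp only [expect]; linarith

end LogMoment

/-! ### Minimising over the degrees of freedom -/

section Minimisation

open Set Filter Topology Real

variable {n : ℕ}

/-- The part of the weighted Kullback-Leibler divergence that depends on the degrees of freedom. -/
def dofObjective (n : ℕ) (A B q : ℝ) : ℝ :=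
  q / 2 * B - A * (log (Gamma ((q + n) / 2)) - log (Gamma (q / 2)))

lemma hasDerivAt_dofObjective (A B : ℝ) {q : ℝ} (hq : 0 < q) :
    HasDerivAt (dofObjective n A B) ((B - A * Delta n q) / 2) q := by
  refine ((((hasDerivAt_id q).div_const 2).mul_const B).sub
    ((hasDerivAt_log_Gamma_sub n hq).const_mul A)).congr_deriv ?_
  ring

/-- As `Delta n` strictly decreases, the derivative `(B - A Δ)/2` is negative before its zero and
positive after it, so a critical point is a global minimum. -/
lemma isMinOn_dofObjective_iff (hn : 0 < n) {A B p : ℝ} (hA : 0 < A) (hp : 0 < p) :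
    IsMinOn (dofObjective n A B) (Ioi 0) p ↔ Delta n p = B / A := by
  rw [eq_div_iff hA.ne']
  constructor
  · intro h
    have := (h.isLocalMin (Ioi_mem_nhds hp)).hasDerivAt_eq_zero (hasDerivAt_dofObjective A B hp)
    linarith
  · intro h q hq
    have hq : 0 < q := hq
    change dofObjective n A B p ≤ dofObjective n A B q
    rcases le_total q p with hqp | hpq
    · refine antitoneOn_of_deriv_nonpos (convex_Ioc 0 p)
        (fun x hx => (hasDerivAt_dofObjective A B hx.1).continuousAt.continuousWithinAt)
        (fun x hx => ?_) (fun x hx => ?_) ⟨hq, hqp⟩ ⟨hp, le_rfl⟩ hqp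
      · rw [interior_Ioc] at hx
        exact (hasDerivAt_dofObjective A B hx.1).differentiableAt.differentiableWithinAt
      · rw [interior_Ioc] at hx
        rw [(hasDerivAt_dofObjective A B hx.1).deriv]
        have := mul_lt_mul_of_pos_left (strictAntiOn_Delta hn hx.1 hp hx.2) hA
        linarith
    · refine monotoneOn_of_deriv_nonneg (convex_Ici p)
        (fun x hx => (hasDerivAt_dofObjective A B
          (hp.trans_le hx)).continuousAt.continuousWithinAt)
        (fun x hx => ?_) (fun x hx => ?_) self_mem_Ici hpq hpq
      · rw [interior_Ici] at hx
        exact (hasDerivAt_dofObjective A B (hp.trans hx)).differentiableAt.differentiableWithinAt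
      · rw [interior_Ici] at hx
        rw [(hasDerivAt_dofObjective A B (hp.trans hx)).deriv]
        have := mul_lt_mul_of_pos_left
          (strictAntiOn_Delta hn hp (show x ∈ Ioi 0 from hp.trans hx) hx) hA
        linarith

lemma existsUnique_isMinOn_dofObjective (hn : 0 < n) {A B : ℝ} (hA : 0 < A) (hB : 0 < B) :
    ∃! p, 0 < p ∧ IsMinOn (dofObjective n A B) (Ioi 0) p := by
  obtain ⟨p, hp, hpB⟩ := exists_Delta_eq hn (div_pos hB hA)
  refine ⟨p, ⟨hp, (isMinOn_dofObjective_iff hn hA hp).mpr hpB⟩, ?_⟩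
  rintro q ⟨hq, hqmin⟩
  refine (strictAntiOn_Delta hn).injOn hq hp ?_
  rw [(isMinOn_dofObjective_iff hn hA hq).mp hqmin, hpB]

end Minimisation

end StudentKL

/-! ### Weighted divergence from a mixture -/

namespace StudentKL

section Mixture

open Set Filter Topology Real

variable {n : ℕ}

/-- The mixture `∑ α_k g_{2k+1}`. -/
def mixture (n K : ℕ) (α : ℕ → ℝ) (x : EuclideanSpace ℝ (Fin n)) : ℝ :=
  ∑ k ∈ Finset.range K, α k * density n (2 * k + 1) x

lemma continuous_mixture (K : ℕ) (α : ℕ → ℝ) : Continuous (mixture n K α) :=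
  continuous_finsetSum _ fun _ _ => continuous_const.mul (continuous_density _)

variable {K : ℕ} {α : ℕ → ℝ}

lemma mul_density_le_mixture (h0 : ∀ k ∈ Finset.range K, 0 ≤ α k) {k : ℕ}
    (hk : k ∈ Finset.range K) (x : EuclideanSpace ℝ (Fin n)) :
    α k * density n (2 * k + 1) x ≤ mixture n K α x :=
  Finset.single_le_sum (f := fun k : ℕ => α k * density n (2 * k + 1) x)
    (fun i hi => mul_nonneg (h0 i hi) (density_pos (by positivity) x).le) hk

lemma mixture_pos (h0 : ∀ k ∈ Finset.range K, 0 ≤ α k) (h1 : ∑ k ∈ Finset.range K, α k = 1)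
    (x : EuclideanSpace ℝ (Fin n)) : 0 < mixture n K α x := by
  obtain ⟨k, hk, hne⟩ := Finset.exists_ne_zero_of_sum_ne_zero (h1.trans_ne one_ne_zero)
  exact (mul_pos ((h0 k hk).lt_of_ne' hne) (density_pos (by positivity) x)).trans_le
    (mul_density_le_mixture h0 hk x)

/-- Mixtures of Student densities have at least polynomial decay. -/
lemma exists_logMoment_le (h0 : ∀ k ∈ Finset.range K, 0 ≤ α k)
    (h1 : ∑ k ∈ Finset.range K, α k = 1) : ∃ C : ℝ, ∀ x : EuclideanSpace ℝ (Fin n),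
      logMoment x ≤ C + 2 * |log (mixture n K α x)| := by
  set M := ∑ k ∈ Finset.range K, α k * normConst n (2 * k + 1) with hM
  refine ⟨2 * log M, fun x => ?_⟩
  have hf := mixture_pos h0 h1 x
  have hle : mixture n K α x ≤ M * exp (logMoment x * (-(1 / 2))) := by
    rw [mixture, hM, Finset.sum_mul]
    refine Finset.sum_le_sum fun k hk => ?_
    rw [density_eq, mul_assoc, rpow_one_add_norm_sq_eq]
    have hc := normConst_pos (n := n) (p := 2 * k + 1) (by positivity)
    refine mul_le_mul_of_nonneg_left (mul_le_mul_of_nonneg_left (exp_le_exp.mpr ?_) hc.le) (h0 k hk)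
    -- Every exponent `(2k + 1 + n)/2` is at least `1/2`, whence the factor 2 in the bound.
    refine mul_le_mul_of_nonneg_left ?_ (logMoment_nonneg x)
    have : (0 : ℝ) ≤ k := by positivity
    have : (0 : ℝ) ≤ n := by positivity
    linarith
  have hM0 : 0 < M := pos_of_mul_pos_left (hf.trans_le hle) (exp_pos _).le
  have h2 := log_le_log hf hle
  rw [log_mul hM0.ne' (exp_pos _).ne', log_exp] at h2
  have := neg_abs_le (log (mixture n K α x))
  linarith

variable {φ : EuclideanSpace ℝ (Fin n) → ℝ}

/-- The only integrability assumed involves `log` of the mixture; polynomial decay bounds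
`logMoment` by that logarithm. -/
lemma integrable_weight (h0 : ∀ k ∈ Finset.range K, 0 ≤ α k)
    (h1 : ∑ k ∈ Finset.range K, α k = 1) (hφ : Measurable φ) (hφ0 : ∀ x, 0 ≤ φ x)
    (hint : Integrable fun x => φ x * mixture n K α x * max 1 |log (mixture n K α x)|) :
    Integrable (fun x => φ x * mixture n K α x) ∧
    Integrable (fun x => φ x * mixture n K α x * log (mixture n K α x)) ∧
    Integrable fun x => φ x * logMoment x * mixture n K α x := by
  have hfm : Measurable (mixture n K α) := (continuous_mixture K α).measurable
  have hLm : Measurable (logMoment (n := n)) := continuous_logMoment.measurable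
  have hw : ∀ x, 0 ≤ φ x * mixture n K α x := fun x =>
    mul_nonneg (hφ0 x) (mixture_pos h0 h1 x).le
  have i1 : Integrable fun x => φ x * mixture n K α x := by
    refine hint.mono' (by fun_prop) (Eventually.of_forall fun x => ?_)
    rw [norm_of_nonneg (hw x)]
    exact le_mul_of_one_le_right (hw x) (le_max_left _ _)
  have i2 : Integrable fun x => φ x * mixture n K α x * log (mixture n K α x) := by
    refine hint.mono' (by fun_prop) (Eventually.of_forall fun x => ?_)
    rw [norm_mul, norm_of_nonneg (hw x)]
    exact mul_le_mul_of_nonneg_left (le_max_right _ _) (hw x)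
  refine ⟨i1, i2, ?_⟩
  obtain ⟨C, hC⟩ := exists_logMoment_le (n := n) h0 h1
  refine ((i1.const_mul C).add (i2.norm.const_mul 2)).mono' (by fun_prop)
    (Eventually.of_forall fun x => ?_)
  rw [mul_right_comm, norm_of_nonneg (mul_nonneg (hw x) (logMoment_nonneg x)), Pi.add_apply,
    norm_mul, norm_of_nonneg (hw x), norm_eq_abs]
  have := mul_le_mul_of_nonneg_left (hC x) (hw x)
  linarith

lemma integrable_mul_density (h0 : ∀ k ∈ Finset.range K, 0 ≤ α k)
    {h : EuclideanSpace ℝ (Fin n) → ℝ} (hh : Measurable h) (hh0 : ∀ x, 0 ≤ h x)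
    (hint : Integrable fun x => h x * mixture n K α x) {k : ℕ} (hk : k ∈ Finset.range K)
    (hα : α k ≠ 0) : Integrable fun x => h x * density n (2 * k + 1) x := by
  have hd : Measurable (density n (2 * k + 1)) := (continuous_density _).measurable
  have hα0 : 0 < α k := (h0 k hk).lt_of_ne' hα
  refine (hint.const_mul (α k)⁻¹).mono' (by fun_prop) (Eventually.of_forall fun x => ?_)
  rw [norm_of_nonneg (mul_nonneg (hh0 x) (density_pos (by positivity) x).le),
    inv_mul_eq_div, le_div_iff₀ hα0, mul_assoc, mul_comm (density n _ x)]
  exact mul_le_mul_of_nonneg_left (mul_density_le_mixture h0 hk x) (hh0 x)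

lemma expectW_expect (h0 : ∀ k ∈ Finset.range K, 0 ≤ α k)
    {h : EuclideanSpace ℝ (Fin n) → ℝ} (hh : Measurable h) (hh0 : ∀ x, 0 ≤ h x)
    (hint : Integrable fun x => h x * mixture n K α x) :
    expectW K α (fun w => expect (density n w) h) = ∫ x, h x * mixture n K α x := by
  have h1 : ∀ x, h x * mixture n K α x =
      ∑ k ∈ Finset.range K, α k * (h x * density n (2 * k + 1) x) := fun x => by
    rw [mixture, Finset.mul_sum]
    exact Finset.sum_congr rfl fun k _ => by ring
  simp_rw [h1]
  rw [integral_finsetSum]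
  · simp only [expectW, expect, integral_const_mul]
  · intro k hk
    -- `h` need not be integrable against a component of weight zero; that summand is identically 0.
    by_cases hα : α k = 0
    · simp [hα]
    · exact (integrable_mul_density h0 hh hh0 hint hk hα).const_mul _

/-- `logMoment` vanishes only at the origin, a null set for `n > 0`, so a zero integral would force
`w = 0` almost everywhere. -/
lemma integral_mul_logMoment_pos (hn : 0 < n) {w : EuclideanSpace ℝ (Fin n) → ℝ}
    (hw0 : ∀ x, 0 ≤ w x) (hint : Integrable fun x => w x * logMoment x)
    (hne : ∫ x, w x ≠ 0) : 0 < ∫ x, w x * logMoment x := by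
  have hnn : ∀ x, 0 ≤ w x * logMoment x := fun x => mul_nonneg (hw0 x) (logMoment_nonneg x)
  refine (integral_nonneg hnn).lt_of_ne' fun h => hne ?_
  rw [integral_eq_zero_iff_of_nonneg hnn hint] at h
  have : Nontrivial (EuclideanSpace ℝ (Fin n)) := by
    obtain ⟨x, hx⟩ := exists_logMoment_ne hn 0
    exact ⟨x, 0, fun h => hx (by simp [h, logMoment])⟩
  have hne0 : ∀ᵐ x : EuclideanSpace ℝ (Fin n), x ≠ 0 := by
    simp [ae_iff]
  refine integral_eq_zero_of_ae ?_
  filter_upwards [h, hne0] with x hx hx0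
  have hL : 0 < logMoment x := log_pos (by have := norm_pos_iff.mpr hx0; simp [hx0])
  exact (mul_eq_zero.mp hx).resolve_right hL.ne'

lemma log_mixture_div_density (h0 : ∀ k ∈ Finset.range K, 0 ≤ α k)
    (h1 : ∑ k ∈ Finset.range K, α k = 1) {q : ℝ} (hq : 0 < q) (x : EuclideanSpace ℝ (Fin n)) :
    log (mixture n K α x / density n q x) =
      log (mixture n K α x) - log (normConst n q) + (q + n) / 2 * logMoment x := by
  have hc := normConst_pos (n := n) hq
  rw [log_div (mixture_pos h0 h1 x).ne' (density_pos hq x).ne', density_eq,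
    rpow_one_add_norm_sq_eq, log_mul hc.ne' (exp_pos _).ne', log_exp]
  ring

/-- The best approximation of a mixture by a single Student density, for the weighted
Kullback-Leibler divergence. -/
theorem weightedKL_mixture (hn : 0 < n) {g : EuclideanSpace ℝ (Fin n) → ℝ}
    (hmix : IsMixture K α g) (hφ : Measurable φ) (hφ0 : ∀ x, 0 ≤ φ x)
    (hint : Integrable fun x => φ x * g x * max 1 |log (g x)|) (hne : expect g φ ≠ 0) :
    (∀ q : ℝ, 0 < q → Integrable fun x => φ x * g x * log (g x / density n q x)) ∧
    (∀ q : ℝ, 0 < q → FiniteExpect (density n q) logMoment) ∧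
    FiniteExpect g φ ∧
    FiniteExpect g (fun x => φ x * logMoment x) ∧
    (∀ k ∈ Finset.range K, α k ≠ 0 →
      FiniteExpect (density n (2 * k + 1)) φ ∧
      FiniteExpect (density n (2 * k + 1)) (fun x => φ x * logMoment x)) ∧
    (∃! p : ℝ, 0 < p ∧ IsMinOn (fun q => weightedKL φ g (density n q)) (Ioi 0) p) ∧
    ∀ p : ℝ, 0 < p →
      (IsMinOn (fun q => weightedKL φ g (density n q)) (Ioi 0) p ↔
        Delta n p =
          expectW K α (fun w => expect (density n w) (fun x => φ x * logMoment x)) /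
          expectW K α (fun w => expect (density n w) φ)) ∧
      (Delta n p =
          expectW K α (fun w => expect (density n w) (fun x => φ x * logMoment x)) /
          expectW K α (fun w => expect (density n w) φ) ↔
        expect (density n p) logMoment * expect g φ =
          expect g (fun x => φ x * logMoment x)) := by
  obtain ⟨h0, h1, hae⟩ := hmix
  change g =ᵐ[volume] mixture n K α at hae
  have hint' : Integrable fun x => φ x * mixture n K α x * max 1 |log (mixture n K α x)| := by
    refine hint.congr ?_
    filter_upwards [hae] with x hx
    rw [hx]
  obtain ⟨i1, i2, i3⟩ := integrable_weight h0 h1 hφ hφ0 hint'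
  have hLφ : Measurable fun x => φ x * logMoment x := hφ.mul continuous_logMoment.measurable
  have hLφ0 : ∀ x, 0 ≤ φ x * logMoment x := fun x => mul_nonneg (hφ0 x) (logMoment_nonneg x)
  have hexp : ∀ h : EuclideanSpace ℝ (Fin n) → ℝ,
      (fun x => h x * g x) =ᵐ[volume] fun x => h x * mixture n K α x := fun h => by
    filter_upwards [hae] with x hx
    rw [hx]
  have hA : expect g φ = ∫ x, φ x * mixture n K α x := integral_congr_ae (hexp φ)
  have hB : expect g (fun x => φ x * logMoment x) =
      ∫ x, φ x * logMoment x * mixture n K α x := integral_congr_ae (hexp _)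
  rw [expectW_expect h0 hφ hφ0 i1, expectW_expect h0 hLφ hLφ0 i3, ← hA, ← hB]
  have hApos : 0 < expect g φ := by
    refine lt_of_le_of_ne ?_ hne.symm
    rw [hA]
    exact integral_nonneg fun x => mul_nonneg (hφ0 x) (mixture_pos h0 h1 x).le
  have hBpos : 0 < expect g (fun x => φ x * logMoment x) := by
    rw [hB]
    simp_rw [mul_right_comm (φ _) (logMoment _)] at i3 ⊢
    exact integral_mul_logMoment_pos hn (fun x => mul_nonneg (hφ0 x) (mixture_pos h0 h1 x).le) i3
      (by rwa [← hA])
  set A := expect g φ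
  set B := expect g (fun x => φ x * logMoment x)
  have hKLae : ∀ q : ℝ, 0 < q → (fun x => φ x * g x * log (g x / density n q x)) =ᵐ[volume]
      fun x => φ x * mixture n K α x * log (mixture n K α x)
        - log (normConst n q) * (φ x * mixture n K α x)
        + (q + n) / 2 * (φ x * logMoment x * mixture n K α x) := fun q hq => by
    filter_upwards [hae] with x hx
    rw [hx, log_mixture_div_density h0 h1 hq]
    ring
  have i12 : ∀ q : ℝ, Integrable fun x => φ x * mixture n K α x * log (mixture n K α x)
        - log (normConst n q) * (φ x * mixture n K α x) := fun q => i2.sub (i1.const_mul _)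
  -- The bracket is independent of `q`: it collects the entropy term, the power of `π` in
  -- `normConst`, and the dimension part of the exponent.
  have hKL : ∀ q : ℝ, 0 < q → weightedKL φ g (density n q) =
      ((∫ x, φ x * mixture n K α x * log (mixture n K α x)) + A * (n / 2 * log π) + n / 2 * B) +
        dofObjective n A B q := fun q hq => by
    rw [weightedKL, integral_congr_ae (hKLae q hq),
      integral_add (i12 q) (i3.const_mul _), integral_sub i2 (i1.const_mul _), integral_const_mul,
      integral_const_mul, ← hA, ← hB, log_normConst hq, dofObjective]
    ring
  have hmin : ∀ p : ℝ, 0 < p →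
      (IsMinOn (fun q => weightedKL φ g (density n q)) (Ioi 0) p ↔
        IsMinOn (dofObjective n A B) (Ioi 0) p) := fun p hp => by
    simp only [isMinOn_iff]
    refine forall₂_congr fun q hq => ?_
    rw [hKL p hp, hKL q hq, add_le_add_iff_left]
  refine ⟨fun q hq => ?_, fun q hq => finiteExpect_density_logMoment hq,
    i1.congr (hexp φ).symm, i3.congr (hexp _).symm, fun k hk hα =>
    ⟨integrable_mul_density h0 hφ hφ0 i1 hk hα, integrable_mul_density h0 hLφ hLφ0 i3 hk hα⟩,
    ?_, fun p hp => ⟨?_, ?_⟩⟩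
  · exact ((i12 q).add (i3.const_mul _)).congr (hKLae q hq).symm
  · obtain ⟨p, ⟨hp, hpmin⟩, huniq⟩ := existsUnique_isMinOn_dofObjective hn hApos hBpos
    exact ⟨p, ⟨hp, (hmin p hp).mpr hpmin⟩, fun q hq => huniq q ⟨hq.1, (hmin q hq.1).mp hq.2⟩⟩
  · rw [hmin p hp, isMinOn_dofObjective_iff hn hApos hp]
  · rw [expect_density_logMoment hp, eq_div_iff hApos.ne']

end Mixture

end StudentKL

end

/-! ### The main theorem -/

theorem theorem2p4 {n : ℕ} (hn : 0 < n)
    {Ω : Type*} [MeasurableSpace Ω] (P : Measure Ω) [IsProbabilityMeasure P]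
    (px py : ℕ) (hpx : Odd px) (hpy : Odd py)
    (X Y : Ω → EuclideanSpace ℝ (Fin n))
    (hX : HasLaw X (StudentKL.law n px) P) (hY : HasLaw Y (StudentKL.law n py) P)
    (hXY : IndepFun X Y P)
    (Z : Ω → EuclideanSpace ℝ (Fin n)) (hZ : Z = fun ω => (1 / 2 : ℝ) • (X ω + Y ω))
    (gZ : EuclideanSpace ℝ (Fin n) → ℝ) (hgZ : gZ = fun x => (pdf Z P volume x).toReal) :
    -- `Z` has a density, and it is a mixture of the `g_{2k+1}`, `0 ≤ k ≤ (px + py) / 2 - 1`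
    HasPDF Z P volume ∧
    (∃ α : ℕ → ℝ, StudentKL.IsMixture ((px + py) / 2) α gZ) ∧
    ∀ α : ℕ → ℝ, StudentKL.IsMixture ((px + py) / 2) α gZ →
    ∀ φ : EuclideanSpace ℝ (Fin n) → ℝ, Measurable φ → (∀ x, 0 ≤ φ x) →
      Integrable (fun x => φ x * gZ x * max 1 |Real.log (gZ x)|) →
      StudentKL.expect gZ φ ≠ 0 →
      -- all the integrals below converge
      (∀ q : ℝ, 0 < q →
        Integrable (fun x => φ x * gZ x * Real.log (gZ x / StudentKL.density n q x))) ∧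
      (∀ q : ℝ, 0 < q →
        StudentKL.FiniteExpect (StudentKL.density n q) StudentKL.logMoment) ∧
      StudentKL.FiniteExpect gZ φ ∧
      StudentKL.FiniteExpect gZ (fun x => φ x * StudentKL.logMoment x) ∧
      (∀ k ∈ Finset.range ((px + py) / 2), α k ≠ 0 →
        StudentKL.FiniteExpect (StudentKL.density n (2 * k + 1)) φ ∧
        StudentKL.FiniteExpect (StudentKL.density n (2 * k + 1))
          (fun x => φ x * StudentKL.logMoment x)) ∧
      -- there is exactly one closest `g_{p*}`
      (∃! p : ℝ, 0 < p ∧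
        IsMinOn (fun q => StudentKL.weightedKL φ gZ (StudentKL.density n q)) (Set.Ioi 0) p) ∧
      -- and it is characterised by either of the two equations
      ∀ p : ℝ, 0 < p →
        (IsMinOn (fun q => StudentKL.weightedKL φ gZ (StudentKL.density n q)) (Set.Ioi 0) p ↔
          StudentKL.Delta n p =
            StudentKL.expectW ((px + py) / 2) α (fun w =>
              StudentKL.expect (StudentKL.density n w) (fun x => φ x * StudentKL.logMoment x)) /
            StudentKL.expectW ((px + py) / 2) α (fun w =>
              StudentKL.expect (StudentKL.density n w) φ)) ∧
        (StudentKL.Delta n p =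
            StudentKL.expectW ((px + py) / 2) α (fun w =>
              StudentKL.expect (StudentKL.density n w) (fun x => φ x * StudentKL.logMoment x)) /
            StudentKL.expectW ((px + py) / 2) α (fun w =>
              StudentKL.expect (StudentKL.density n w) φ) ↔
          StudentKL.expect (StudentKL.density n p) StudentKL.logMoment * StudentKL.expect gZ φ =
            StudentKL.expect gZ (fun x => φ x * StudentKL.logMoment x)) := by
  obtain ⟨k, rfl⟩ := hpx
  obtain ⟨l, rfl⟩ := hpy
  have hK : (2 * k + 1 + (2 * l + 1)) / 2 = k + l + 1 := by omega
  push_cast at hX hY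
  rw [hK]
  obtain ⟨α, hα0, hα1, hmap⟩ := StudentKL.exists_mixture hX hY hXY
  rw [← hZ] at hmap
  have hfm : Measurable (StudentKL.mixture n (k + l + 1) α) :=
    (StudentKL.continuous_mixture _ _).measurable
  have hZm : AEMeasurable Z P := by
    rw [hZ]; exact (hX.aemeasurable.add hY.aemeasurable).const_smul (1 / 2 : ℝ)
  have hpdf : HasPDF Z P volume :=
    hasPDF_of_map_eq_withDensity hZm _ hfm.ennreal_ofReal.aemeasurable hmap
  -- The divergence statement concerns arbitrary mixture weights `β`, not only the `α` constructed
  -- here.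
  refine ⟨hpdf, ⟨α, fun i _ => hα0 i, hα1, ?_⟩, fun β hβ φ hφ hφ0 hint hne =>
    StudentKL.weightedKL_mixture hn hβ hφ hφ0 hint hne⟩
  have h := (pdf.eq_of_map_eq_withDensity' _ hfm.ennreal_ofReal.aemeasurable).mp hmap
  filter_upwards [h] with x hx
  simp only [hgZ]
  rw [hx, ENNReal.toReal_ofReal
    (StudentKL.mixture_pos (fun i _ => hα0 i) hα1 x).le]
  rfl
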